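/- \textbf{Setting.} Let $(\breve N,\breve g)$ be a smooth semi-Riemannian manifold with Levi-Civita connection $\breve\nabla$, let $p,q$ be positive integers, and let $\breve J$ be a smooth $(1,1)$-tensor field on $\breve N$ with $\breve J^2=p\breve J+qI$, $\breve g(\breve JX,Y)=\breve g(X,\breve JY)$ and $\breve\nabla\breve J=0$; that is, $(\breve N,\breve g,\breve J)$ is a locally metallic semi-Riemannian manifold. Let $N$ be a lightlike submanifold of $\breve N$: an immersed submanifold whose radical distribution $\mathrm{Rad}(TN)=TN\cap TN^\perp$ has constant rank $r\ge 1$. Fix smooth vector bundles $S(TN)$, $S(TN^\perp)$ and $ltr(TN)$ over $N$ such that $TN=\mathrm{Rad}(TN)\oplus S(TN)$, $TN^\perp=\mathrm{Rad}(TN)\oplus S(TN^\perp)$, and $ltr(TN)$ is isotropic, orthogonal to $S(TN)$ and to $S(TN^\perp)$, and $$T\breve N|_N=S(TN)\oplus \mathrm{Rad}(TN)\oplus ltr(TN)\oplus S(TN^\perp).$$ For $W,U\in\Gamma(TN)$ let $\nabla_WU$ be the component of $\breve\nabla_WU$ in $TN=S(TN)\oplus\mathrm{Rad}(TN)$ (the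 induced connection on $N$); for $Z\in\Gamma(S(TN^\perp))$ let $\nabla^s_WZ$ be the component of $\breve\nabla_WZ$ in $S(TN^\perp)$; and for $Z\in S(TN^\perp)$ let $B_2Z$ be the component of $\breve JZ$ in $S(TN)$, all with respect to this decomposition. Let $g$ be the degenerate metric on $N$ induced by $\breve g$. The connection $\nabla$ is called a metric connection if $(\nabla_Wg)(U,V)=W(g(U,V))-g(\nabla_WU,V)-g(U,\nabla_WV)=0$ for all $W,U,V\in\Gamma(TN)$. \textbf{Theorem.} Assume that $N$ is a screen transversal anti-invariant lightlike submanifold, i.e. $\breve J\,\mathrm{Rad}(TN)\subset S(TN^\perp)$ and $\breve J\,S(TN)\subset S(TN^\perp)$. Then the induced connection $\nabla$ on $N$ is a metric connection if and only if $$B_2\nabla^s_W\breve J\xi=0\qquad\text{for all } W\in\Gamma(TN),\ \xi\in\Gamma(\mathrm{Rad}(TN)).$$ -/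

import Mathlib

open scoped Manifold ContDiff
open Bundle

set_option linter.unusedSectionVars false

noncomputable section

namespace Lightlike

section Ambient

variable {E : Type*} [NormedAddCommGroup E] [NormedSpace ℝ E] [FiniteDimensional ℝ E]
  {M : Type*} [TopologicalSpace M] [ChartedSpace E M] [IsManifold 𝓘(ℝ, E) ∞ M]

variable (E M) in
/-- A (smooth) semi-Riemannian metric on `M`: a smooth field of nondegenerate symmetric bilinear
forms on the tangent spaces. -/
structure SemiRiemannianMetric where
  /-- The bilinear form on the tangent space at `x`. -/
  inner (x : M) : TangentSpace 𝓘(ℝ, E) x →L[ℝ] TangentSpace 𝓘(ℝ, E) x →L[ℝ] ℝ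
  symm (x : M) (v w : TangentSpace 𝓘(ℝ, E) x) : inner x v w = inner x w v
  nondegenerate (x : M) (v : TangentSpace 𝓘(ℝ, E) x) : (∀ w, inner x v w = 0) → v = 0
  contMDiff : ContMDiff 𝓘(ℝ, E) (𝓘(ℝ, E).prod 𝓘(ℝ, E →L[ℝ] E →L[ℝ] ℝ)) ∞
    (fun x ↦ TotalSpace.mk' (E →L[ℝ] E →L[ℝ] ℝ)
      (E := fun x : M ↦ TangentSpace 𝓘(ℝ, E) x →L[ℝ] TangentSpace 𝓘(ℝ, E) x →L[ℝ] ℝ)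
      x (inner x))

/-- `cov` is the Levi-Civita connection of `g`: it is torsion-free and `g` is parallel.
(By Koszul's formula this determines `cov` on differentiable vector fields.)
Mathlib writes `cov Y x (X x)` for `(∇_X Y) x`. -/
structure IsLeviCivita (g : SemiRiemannianMetric E M)
    (cov : CovariantDerivative 𝓘(ℝ, E) E (TangentSpace 𝓘(ℝ, E) : M → Type _)) : Prop where
  torsion_eq_zero :
    haveI : CompleteSpace E := FiniteDimensional.complete ℝ E
    cov.torsion = 0
  metric (x : M) (Y Z : ∀ x : M, TangentSpace 𝓘(ℝ, E) x)
    (hY : MDifferentiableAt 𝓘(ℝ, E) 𝓘(ℝ, E).tangent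
      (fun y ↦ (⟨y, Y y⟩ : TangentBundle 𝓘(ℝ, E) M)) x)
    (hZ : MDifferentiableAt 𝓘(ℝ, E) 𝓘(ℝ, E).tangent
      (fun y ↦ (⟨y, Z y⟩ : TangentBundle 𝓘(ℝ, E) M)) x)
    (v : TangentSpace 𝓘(ℝ, E) x) :
    mvfderiv 𝓘(ℝ, E) (fun y ↦ g.inner y (Y y) (Z y)) x v =
      g.inner x (cov Y x v) (Z x) + g.inner x (Y x) (cov Z x v)

/-- `(M, g, J)` is a metallic semi-Riemannian manifold with parameters `p`, `q`: `J` is a smooth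
`(1,1)`-tensor field with `J² = p J + q I`, where `p`, `q` are positive integers, and `g` is
`J`-compatible. -/
structure IsMetallic (g : SemiRiemannianMetric E M) (p q : ℕ)
    (J : ∀ x : M, TangentSpace 𝓘(ℝ, E) x →L[ℝ] TangentSpace 𝓘(ℝ, E) x) : Prop where
  p_pos : 0 < p
  q_pos : 0 < q
  contMDiff : ContMDiff 𝓘(ℝ, E) (𝓘(ℝ, E).prod 𝓘(ℝ, E →L[ℝ] E)) ∞
    (fun x ↦ TotalSpace.mk' (E →L[ℝ] E)
      (E := fun x : M ↦ TangentSpace 𝓘(ℝ, E) x →L[ℝ] TangentSpace 𝓘(ℝ, E) x) x (J x))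
  sq (x : M) (v : TangentSpace 𝓘(ℝ, E) x) : J x (J x v) = (p : ℝ) • J x v + (q : ℝ) • v
  compatible (x : M) (v w : TangentSpace 𝓘(ℝ, E) x) :
    g.inner x (J x v) w = g.inner x v (J x w)

/-- The `(1,1)`-tensor field `J` is parallel: `∇_W (J U) = J (∇_W U)`. -/
def IsParallel (cov : CovariantDerivative 𝓘(ℝ, E) E (TangentSpace 𝓘(ℝ, E) : M → Type _))
    (J : ∀ x : M, TangentSpace 𝓘(ℝ, E) x →L[ℝ] TangentSpace 𝓘(ℝ, E) x) : Prop :=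
  ∀ (x : M) (U : ∀ x : M, TangentSpace 𝓘(ℝ, E) x),
    MDifferentiableAt 𝓘(ℝ, E) 𝓘(ℝ, E).tangent
      (fun y ↦ (⟨y, U y⟩ : TangentBundle 𝓘(ℝ, E) M)) x →
    ∀ w : TangentSpace 𝓘(ℝ, E) x, cov (fun y ↦ J y (U y)) x w = J x (cov U x w)

/-- `(M, g, J)` is a locally metallic semi-Riemannian manifold and `cov` is its Levi-Civita
connection. -/
structure IsLocallyMetallic (g : SemiRiemannianMetric E M)
    (cov : CovariantDerivative 𝓘(ℝ, E) E (TangentSpace 𝓘(ℝ, E) : M → Type _)) (p q : ℕ)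
    (J : ∀ x : M, TangentSpace 𝓘(ℝ, E) x →L[ℝ] TangentSpace 𝓘(ℝ, E) x) : Prop where
  isLeviCivita : IsLeviCivita g cov
  isMetallic : IsMetallic g p q J
  isParallel : IsParallel cov J

end Ambient

section Along

variable {E : Type*} [NormedAddCommGroup E] [NormedSpace ℝ E] [FiniteDimensional ℝ E]
  {M : Type*} [TopologicalSpace M] [ChartedSpace E M] [IsManifold 𝓘(ℝ, E) ∞ M]
  {E' : Type*} [NormedAddCommGroup E'] [NormedSpace ℝ E'] [FiniteDimensional ℝ E']
  {N : Type*} [TopologicalSpace N] [ChartedSpace E' N] [IsManifold 𝓘(ℝ, E') ∞ N]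

/-- `W` is a smooth vector field on `N`, i.e. `W ∈ Γ(TN)`. -/
def IsSmoothField (W : ∀ x : N, TangentSpace 𝓘(ℝ, E') x) : Prop :=
  ContMDiff 𝓘(ℝ, E') 𝓘(ℝ, E').tangent ∞ (fun x ↦ (⟨x, W x⟩ : TangentBundle 𝓘(ℝ, E') N))

/-- The family `D x ⊆ T_{f x} M`, `x ∈ N`, is a smooth vector subbundle of the pullback bundle
`f^* TM`: locally it has a smooth frame. (For `f = id` this is a smooth distribution.) -/
def IsSmoothSubbundle (f : N → M) (D : ∀ x : N, Submodule ℝ (TangentSpace 𝓘(ℝ, E) (f x))) :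
    Prop :=
  ∀ x₀ : N, ∃ u : Set N, IsOpen u ∧ x₀ ∈ u ∧
    ∃ (k : ℕ) (s : Fin k → ∀ x : N, TangentSpace 𝓘(ℝ, E) (f x)),
      (∀ i, ContMDiffOn 𝓘(ℝ, E') 𝓘(ℝ, E).tangent ∞
        (fun x ↦ (⟨f x, s i x⟩ : TangentBundle 𝓘(ℝ, E) M)) u) ∧
      ∀ x ∈ u, LinearIndependent ℝ (fun i ↦ s i x) ∧
        Submodule.span ℝ (Set.range fun i ↦ s i x) = D x

/-- The covariant derivative along the map `f` (the connection which `cov` induces on `f^* TM`):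
`covAlong cov f V x w` is `(∇_w V) x` for a vector field `V` along `f`. If `e_i` is the frame
of `TM` near `f x` given by the trivialization at `f x`, and `V = ∑ v_i (e_i ∘ f)`, then
`(∇_w V) x = ∑ (d v_i) w • e_i (f x) + ∑ v_i x • ∇_{df w} e_i`. -/
def covAlong (cov : CovariantDerivative 𝓘(ℝ, E) E (TangentSpace 𝓘(ℝ, E) : M → Type _))
    (f : N → M) (V : ∀ x : N, TangentSpace 𝓘(ℝ, E) (f x)) (x : N) :
    TangentSpace 𝓘(ℝ, E') x →L[ℝ] TangentSpace 𝓘(ℝ, E) (f x) :=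
  let t := trivializationAt E (TangentSpace 𝓘(ℝ, E) : M → Type _) (f x)
  (t.symmL ℝ (f x)).comp
      (mvfderiv 𝓘(ℝ, E') (fun y ↦ t.continuousLinearMapAt ℝ (f y) (V y)) x) +
    (cov (FiberBundle.extend E (V x)) (f x)).comp (mfderiv 𝓘(ℝ, E') 𝓘(ℝ, E) f x)

/-- For a vector field `Y` on `M`, the derivative of `Y ∘ f` along `f` is `∇_{df w} Y`. -/
theorem covAlong_comp
    (cov : CovariantDerivative 𝓘(ℝ, E) E (TangentSpace 𝓘(ℝ, E) : M → Type _))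
    (f : N → M) (x : N) (hf : MDifferentiableAt 𝓘(ℝ, E') 𝓘(ℝ, E) f x)
    (Y : ∀ y : M, TangentSpace 𝓘(ℝ, E) y)
    (hY : MDifferentiableAt 𝓘(ℝ, E) 𝓘(ℝ, E).tangent
      (fun y ↦ (⟨y, Y y⟩ : TangentBundle 𝓘(ℝ, E) M)) (f x)) (w : TangentSpace 𝓘(ℝ, E') x) :
    covAlong cov f (fun y ↦ Y (f y)) x w =
      cov Y (f x) (mfderiv 𝓘(ℝ, E') 𝓘(ℝ, E) f x w) := by
  set t := trivializationAt E (TangentSpace 𝓘(ℝ, E) : M → Type _) (f x) with ht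
  have hmem : f x ∈ t.baseSet := FiberBundle.mem_baseSet_trivializationAt' (f x)
  have hnb : t.baseSet ∈ nhds (f x) := t.open_baseSet.mem_nhds hmem
  set c : (∀ y : M, TangentSpace 𝓘(ℝ, E) y) → M → E :=
    fun Z y ↦ t.continuousLinearMapAt ℝ y (Z y) with hc
  have hcd : ∀ Z : ∀ y : M, TangentSpace 𝓘(ℝ, E) y,
      MDifferentiableAt 𝓘(ℝ, E) 𝓘(ℝ, E).tangent
        (fun y ↦ (⟨y, Z y⟩ : TangentBundle 𝓘(ℝ, E) M)) (f x) →
      MDifferentiableAt 𝓘(ℝ, E) 𝓘(ℝ, E) (c Z) (f x) := by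
    intro Z hZ
    refine ((t.mdifferentiableAt_section_iff 𝓘(ℝ, E) Z hmem).1 hZ).congr_of_eventuallyEq ?_
    filter_upwards [hnb] with y hy
    simp only [hc]
    rw [Trivialization.continuousLinearMapAt_apply, Trivialization.coe_linearMapAt_of_mem _ hy]
  -- the first-order operator `Z ↦ d(c Z)` in the trivialization
  have hT : TensorialAt 𝓘(ℝ, E) E
      (fun Z : ∀ y : M, TangentSpace 𝓘(ℝ, E) y ↦
        cov Z (f x) - (t.symmL ℝ (f x)).comp (mvfderiv 𝓘(ℝ, E) (c Z) (f x))) (f x) := by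
    constructor
    · intro a Z ha hZ
      have h1 : c (a • Z) = a • c Z := by
        funext y
        simp [hc]
      ext v
      rw [h1, cov.isCovariantDerivativeOn.leibniz hZ ha, mvfderiv_smul ha (hcd Z hZ)]
      have h2 : t.symmL ℝ (f x) (c Z (f x)) = Z (f x) :=
        t.symmL_continuousLinearMapAt hmem (Z (f x))
      simp [h2]
      module
    · intro Z Z' hZ hZ'
      have h1 : c (Z + Z') = c Z + c Z' := by
        funext y
        simp [hc]
      ext v
      rw [h1, cov.isCovariantDerivativeOn.add hZ hZ', mvfderiv_add (hcd Z hZ) (hcd Z' hZ')]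
      simp
      abel
  have hext := FiberBundle.mdifferentiableAt_extend 𝓘(ℝ, E) E (Y (f x))
  have hp := hT.pointwise hY hext (by simp)
  have hconst : mvfderiv 𝓘(ℝ, E) (c (FiberBundle.extend E (Y (f x)))) (f x) = 0 := by
    have : c (FiberBundle.extend E (Y (f x))) =ᶠ[nhds (f x)]
        fun _ ↦ (t ⟨f x, Y (f x)⟩).2 := by
      filter_upwards [hnb] with y hy
      have h5 : FiberBundle.extend E (Y (f x)) y = t.symmL ℝ y (t ⟨f x, Y (f x)⟩).2 := by
        rw [Trivialization.symmL_apply _ hy]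
        rfl
      simp only [hc]
      rw [h5]
      exact Trivialization.continuousLinearMapAt_symmL (R := ℝ) t hy (t ⟨f x, Y (f x)⟩).2
    rw [mvfderiv, this.mfderiv_eq]
    exact mvfderiv_const _
  simp only [hconst, ContinuousLinearMap.comp_zero, sub_zero] at hp
  have hch : mvfderiv 𝓘(ℝ, E') (fun y ↦ t.continuousLinearMapAt ℝ (f y) (Y (f y))) x =
      (mvfderiv 𝓘(ℝ, E) (c Y) (f x)).comp (mfderiv 𝓘(ℝ, E') 𝓘(ℝ, E) f x) := by
    have h3 := mfderiv_comp x (hcd Y hY) hf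
    have h4 : (c Y ∘ f) = fun y ↦ t.continuousLinearMapAt ℝ (f y) (Y (f y)) := rfl
    rw [h4] at h3
    simp only [mvfderiv]
    rw [h3]
    rfl
  change ((t.symmL ℝ (f x)).comp
      (mvfderiv 𝓘(ℝ, E') (fun y ↦ t.continuousLinearMapAt ℝ (f y) (Y (f y))) x) +
    (cov (FiberBundle.extend E (Y (f x))) (f x)).comp (mfderiv 𝓘(ℝ, E') 𝓘(ℝ, E) f x)) w = _
  rw [hch, ← hp]
  simp

/-- The normal space `T_xN^⊥ = {u ∈ T_{f x} M | g(u, v) = 0 for all v ∈ T_x N}`. -/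
def normalSpace (g : SemiRiemannianMetric E M) (f : N → M) (x : N) :
    Submodule ℝ (TangentSpace 𝓘(ℝ, E) (f x)) where
  carrier := {u | ∀ v : TangentSpace 𝓘(ℝ, E') x,
    g.inner (f x) u (mfderiv 𝓘(ℝ, E') 𝓘(ℝ, E) f x v) = 0}
  zero_mem' := by simp
  add_mem' := by
    intro a b ha hb v
    have h1 := ha v
    have h2 := hb v
    simp only [map_add, add_apply]
    rw [h1, h2, add_zero]
  smul_mem' := by
    intro c a ha v
    have h1 := ha v
    simp only [map_smul, smul_apply]
    rw [h1, smul_zero]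

/-- The radical `Rad(T_xN) = T_xN ∩ T_xN^⊥`, as a subspace of `T_xN`. -/
def radical (g : SemiRiemannianMetric E M) (f : N → M) (x : N) :
    Submodule ℝ (TangentSpace 𝓘(ℝ, E') x) :=
  (normalSpace (E' := E') g f x).comap (mfderiv 𝓘(ℝ, E') 𝓘(ℝ, E) f x).toLinearMap

/-- The differential of an immersion is injective. -/
theorem injective_mfderiv_of_isImmersion {f : N → M}
    (hf : Manifold.IsImmersion 𝓘(ℝ, E') 𝓘(ℝ, E) ∞ f) (x : N) :
    Function.Injective (mfderiv 𝓘(ℝ, E') 𝓘(ℝ, E) f x) := by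
  obtain ⟨F, _, _, h⟩ := hf.isImmersionAt x
  have hn : (∞ : WithTop ℕ∞) ≠ 0 := by simp
  set φ := h.domChart.extend 𝓘(ℝ, E') with hφdef
  set ψ := h.codChart.extend 𝓘(ℝ, E) with hψdef
  have hφ : MDifferentiableAt 𝓘(ℝ, E') 𝓘(ℝ, E') φ x :=
    (OpenPartialHomeomorph.contMDiffAt_extend h.domChart_mem_maximalAtlas
      h.mem_domChart_source).mdifferentiableAt hn
  have hψ : MDifferentiableAt 𝓘(ℝ, E) 𝓘(ℝ, E) ψ (f x) :=
    (OpenPartialHomeomorph.contMDiffAt_extend h.codChart_mem_maximalAtlas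
      h.mem_codChart_source).mdifferentiableAt hn
  have hfd : MDifferentiableAt 𝓘(ℝ, E') 𝓘(ℝ, E) f x :=
    hf.contMDiff.contMDiffAt.mdifferentiableAt hn
  have hxs : φ.source ∈ nhds x := by
    rw [hφdef, OpenPartialHomeomorph.extend_source]
    exact h.domChart.open_source.mem_nhds h.mem_domChart_source
  have hxt : φ x ∈ φ.target := φ.map_source (mem_of_mem_nhds hxs)
  have hφt : φ.target = h.domChart.target := by simp [hφdef]
  have hsymm : ContMDiffAt 𝓘(ℝ, E') 𝓘(ℝ, E') ∞ φ.symm (φ x) := by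
    have := contMDiffOn_extend_symm (I := 𝓘(ℝ, E')) h.domChart_mem_maximalAtlas
    refine this.contMDiffAt ?_
    simp only [modelWithCornersSelf_coe, Set.image_id]
    exact h.domChart.open_target.mem_nhds (hφt ▸ hxt)
  set L : E → E' := fun z ↦ (h.equiv.symm z).1 with hL
  have hLd : MDifferentiableAt 𝓘(ℝ, E) 𝓘(ℝ, E') L (ψ (f x)) := by
    apply DifferentiableAt.mdifferentiableAt
    exact differentiableAt_fst.comp _ h.equiv.symm.differentiableAt
  have key : ∀ y ∈ φ.source, L (ψ (f y)) = φ y := by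
    intro y hy
    have := h.writtenInCharts (φ.map_source hy)
    simp only [Function.comp] at this
    rw [← hφdef, ← hψdef, φ.left_inv hy] at this
    simp [hL, this]
  have hd : MDifferentiableAt 𝓘(ℝ, E') 𝓘(ℝ, E') φ.symm (L (ψ (f x))) := by
    rw [key x (mem_of_mem_nhds hxs)]
    exact hsymm.mdifferentiableAt hn
  have hev : (fun y ↦ φ.symm (L (ψ (f y)))) =ᶠ[nhds x] id := by
    filter_upwards [hxs] with y hy
    rw [key y hy, φ.left_inv hy, id]
  have hcomp : MDifferentiableAt 𝓘(ℝ, E) 𝓘(ℝ, E') (fun z ↦ φ.symm (L (ψ z))) (f x) :=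
    MDifferentiableAt.comp (f x) (g := φ.symm) (f := fun z ↦ L (ψ z)) hd
      (MDifferentiableAt.comp (f x) (g := L) (f := ψ) hLd hψ)
  have h1 : mfderiv 𝓘(ℝ, E') 𝓘(ℝ, E') (fun y ↦ φ.symm (L (ψ (f y)))) x =
      (mfderiv 𝓘(ℝ, E) 𝓘(ℝ, E') (fun z ↦ φ.symm (L (ψ z))) (f x)).comp
        (mfderiv 𝓘(ℝ, E') 𝓘(ℝ, E) f x) := mfderiv_comp x hcomp hfd
  rw [hev.mfderiv_eq, mfderiv_id] at h1
  intro a b hab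
  have h2 := congrArg (fun T ↦ T a) h1
  have h3 := congrArg (fun T ↦ T b) h1
  simp only [ContinuousLinearMap.comp_apply] at h2 h3
  rw [hab, ← h3] at h2
  exact h2

end Along

section Submanifold

variable {E : Type*} [NormedAddCommGroup E] [NormedSpace ℝ E] [FiniteDimensional ℝ E]
  {M : Type*} [TopologicalSpace M] [ChartedSpace E M] [IsManifold 𝓘(ℝ, E) ∞ M]
  (E' : Type*) [NormedAddCommGroup E'] [NormedSpace ℝ E'] [FiniteDimensional ℝ E']
  (N : Type*) [TopologicalSpace N] [ChartedSpace E' N] [IsManifold 𝓘(ℝ, E') ∞ N]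

/-- A lightlike submanifold `(N, g, S(TN), S(TN^⊥))` of `(M, g)` together with its lightlike
transversal bundle `ltr(TN)`. `T_xN` is identified with its image under the differential of the
immersion `f`. -/
structure LightlikeSubmanifold (g : SemiRiemannianMetric E M) where
  /-- The immersion. -/
  f : N → M
  isImmersion : Manifold.IsImmersion 𝓘(ℝ, E') 𝓘(ℝ, E) ∞ f
  /-- The rank of the radical distribution. -/
  r : ℕ
  r_pos : 0 < r
  finrank_radical (x : N) : Module.finrank ℝ (radical (E' := E') g f x) = r
  /-- The screen distribution `S(TN)`, a complement of `Rad(TN)` in `TN`. -/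
  screen (x : N) : Submodule ℝ (TangentSpace 𝓘(ℝ, E') x)
  screen_smooth : IsSmoothSubbundle (E := E') (E' := E') (M := N) id screen
  screen_isCompl (x : N) : IsCompl (radical g f x) (screen x)
  /-- The screen transversal bundle `S(TN^⊥)`, a complement of `Rad(TN)` in `TN^⊥`. -/
  screenTransversal (x : N) : Submodule ℝ (TangentSpace 𝓘(ℝ, E) (f x))
  screenTransversal_smooth : IsSmoothSubbundle (E' := E') f screenTransversal
  screenTransversal_disjoint (x : N) :
    Disjoint ((radical g f x).map (mfderiv 𝓘(ℝ, E') 𝓘(ℝ, E) f x).toLinearMap)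
      (screenTransversal x)
  screenTransversal_sup (x : N) :
    (radical g f x).map (mfderiv 𝓘(ℝ, E') 𝓘(ℝ, E) f x).toLinearMap ⊔ screenTransversal x =
      normalSpace (E' := E') g f x
  /-- The lightlike transversal bundle `ltr(TN)`: isotropic, orthogonal to `S(TN)` and to
  `S(TN^⊥)`, and such that `tr(TN) = ltr(TN) ⊕ S(TN^⊥)` is a complement of `TN` in `TM|_N`. -/
  ltr (x : N) : Submodule ℝ (TangentSpace 𝓘(ℝ, E) (f x))
  ltr_smooth : IsSmoothSubbundle (E' := E') f ltr
  ltr_isotropic (x : N) : ∀ n ∈ ltr x, ∀ n' ∈ ltr x, g.inner (f x) n n' = 0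
  ltr_orthogonal_screen (x : N) : ∀ n ∈ ltr x, ∀ u ∈ screen x,
    g.inner (f x) n (mfderiv 𝓘(ℝ, E') 𝓘(ℝ, E) f x u) = 0
  ltr_orthogonal_screenTransversal (x : N) : ∀ n ∈ ltr x, ∀ z ∈ screenTransversal x,
    g.inner (f x) n z = 0
  ltr_disjoint (x : N) : Disjoint (ltr x) (screenTransversal x)
  isCompl_transversal (x : N) :
    IsCompl (LinearMap.range (mfderiv 𝓘(ℝ, E') 𝓘(ℝ, E) f x).toLinearMap)
      (ltr x ⊔ screenTransversal x)

namespace LightlikeSubmanifold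

variable {E' N} {g : SemiRiemannianMetric E M} (L : LightlikeSubmanifold E' N g)

/-- The differential of the immersion at `x`, as a linear map `T_xN → T_{f x} M`. -/
def d (x : N) : TangentSpace 𝓘(ℝ, E') x →ₗ[ℝ] TangentSpace 𝓘(ℝ, E) (L.f x) :=
  (mfderiv 𝓘(ℝ, E') 𝓘(ℝ, E) L.f x).toLinearMap

/-- The degenerate metric on `N` induced from `g`. -/
def inducedMetric (x : N) (u v : TangentSpace 𝓘(ℝ, E') x) : ℝ :=
  g.inner (L.f x) (L.d x u) (L.d x v)

/-- `Rad(TN)` at `x`. -/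
def rad (x : N) : Submodule ℝ (TangentSpace 𝓘(ℝ, E') x) := radical g L.f x

theorem d_injective (x : N) : Function.Injective (L.d x) :=
  injective_mfderiv_of_isImmersion L.isImmersion x

/-- `TM|_N = S(TN^⊥) ⊕ (TN ⊕ ltr(TN))`. -/
theorem isCompl_screenTransversal (x : N) :
    IsCompl (L.screenTransversal x) (LinearMap.range (L.d x) ⊔ L.ltr x) := by
  have h := L.isCompl_transversal x
  constructor
  · rw [sup_comm]
    refine (L.ltr_disjoint x).symm.disjoint_sup_right_of_disjoint_sup_left ?_
    rw [sup_comm]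
    exact h.disjoint.symm
  · rw [codisjoint_iff, ← h.sup_eq_top, sup_comm, sup_assoc]; rfl

/-- `TM|_N = S(TN) ⊕ (Rad(TN) ⊕ ltr(TN) ⊕ S(TN^⊥))`. -/
theorem isCompl_screen (x : N) :
    IsCompl ((L.screen x).map (L.d x))
      ((L.rad x).map (L.d x) ⊔ (L.ltr x ⊔ L.screenTransversal x)) := by
  have h := L.isCompl_transversal x
  have hs : (L.screen x).map (L.d x) ⊔ (L.rad x).map (L.d x) = LinearMap.range (L.d x) := by
    rw [← Submodule.map_sup, sup_comm, rad, (L.screen_isCompl x).sup_eq_top, Submodule.map_top]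
  have hd : Disjoint ((L.screen x).map (L.d x)) ((L.rad x).map (L.d x)) :=
    (Submodule.disjoint_map (L.d_injective x) (L.screen_isCompl x).disjoint).symm
  constructor
  · refine hd.disjoint_sup_right_of_disjoint_sup_left ?_
    rw [hs]
    exact h.disjoint
  · rw [codisjoint_iff, ← sup_assoc, hs]
    exact h.sup_eq_top

/-- The induced connection `∇` on `N`, from the Gauss formula `∇̆_W U = ∇_W U + h(W, U)`:
`L.inducedConnection cov U x w` is `(∇_w U) x`, the tangential component of `∇̆_w U` along
`tr(TN) = ltr(TN) ⊕ S(TN^⊥)`. -/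
def inducedConnection (cov : CovariantDerivative 𝓘(ℝ, E) E (TangentSpace 𝓘(ℝ, E) : M → Type _))
    (U : ∀ x : N, TangentSpace 𝓘(ℝ, E') x) (x : N) :
    TangentSpace 𝓘(ℝ, E') x →ₗ[ℝ] TangentSpace 𝓘(ℝ, E') x :=
  (LinearMap.linearProjOfIsCompl (L.ltr x ⊔ L.screenTransversal x) (L.d x) (L.d_injective x)
    (L.isCompl_transversal x)).comp (covAlong cov L.f (fun y ↦ L.d y (U y)) x).toLinearMap

/-- The linear connection `∇` (with `D U x w` standing for `(∇_w U) x`) on `N` is a metric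
connection: `(∇_W g)(U, V) = W (g(U, V)) - g(∇_W U, V) - g(U, ∇_W V)` vanishes for all
`W, U, V ∈ Γ(TN)`. -/
def IsMetricConnection
    (D : (∀ x : N, TangentSpace 𝓘(ℝ, E') x) →
      ∀ x : N, TangentSpace 𝓘(ℝ, E') x →ₗ[ℝ] TangentSpace 𝓘(ℝ, E') x) : Prop :=
  ∀ W U V : ∀ x : N, TangentSpace 𝓘(ℝ, E') x,
    IsSmoothField W → IsSmoothField U → IsSmoothField V → ∀ x : N,
      mvfderiv 𝓘(ℝ, E') (fun y ↦ L.inducedMetric y (U y) (V y)) x (W x) -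
        L.inducedMetric x (D U x (W x)) (V x) - L.inducedMetric x (U x) (D V x (W x)) = 0

/-- The screen transversal connection `∇^s`, from the Weingarten formula
`∇̆_W Z = -A_Z W + ∇^s_W Z + D^ℓ(W, Z)`: for a section `Z` of `S(TN^⊥)`,
`L.screenTransversalConnection cov Z x w` is `(∇^s_w Z) x`, the `S(TN^⊥)`-component of
`∇̆_w Z` in `TM|_N = S(TN^⊥) ⊕ (TN ⊕ ltr(TN))`. -/
def screenTransversalConnection
    (cov : CovariantDerivative 𝓘(ℝ, E) E (TangentSpace 𝓘(ℝ, E) : M → Type _))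
    (Z : ∀ x : N, L.screenTransversal x) (x : N) :
    TangentSpace 𝓘(ℝ, E') x →ₗ[ℝ] L.screenTransversal x :=
  ((L.screenTransversal x).projectionOnto (LinearMap.range (L.d x) ⊔ L.ltr x)
    (L.isCompl_screenTransversal x)).comp
      (covAlong cov L.f (fun y ↦ (Z y : TangentSpace 𝓘(ℝ, E) (L.f y))) x).toLinearMap

/-- `N` is a screen transversal anti-invariant lightlike submanifold: `J Rad(TN) ⊆ S(TN^⊥)`
(i.e. `N` is screen transversal) and `J S(TN) ⊆ S(TN^⊥)`. -/
structure IsScreenTransversalAntiInvariant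
    (J : ∀ x : M, TangentSpace 𝓘(ℝ, E) x →L[ℝ] TangentSpace 𝓘(ℝ, E) x) : Prop where
  rad (x : N) : ∀ ξ ∈ L.rad x, J (L.f x) (L.d x ξ) ∈ L.screenTransversal x
  screen (x : N) : ∀ u ∈ L.screen x, J (L.f x) (L.d x u) ∈ L.screenTransversal x

/-- `B₂ : S(TN^⊥) → S(TN)`: `B₂ U` is the `S(TN)`-component of `J U` in
`TM|_N = S(TN) ⊕ (Rad(TN) ⊕ ltr(TN) ⊕ S(TN^⊥))`. (In the anti-invariant case this is also the
`S(TN)`-component of `J (T₂ U)`, with `T₂` the projection of `S(TN^⊥)` on `J S(TN)` along the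
orthogonal complement of `J S(TN)` in `S(TN^⊥)`: both equal the unique `V` in `S(TN)` with
`g(V, V') = g(U, J V')` for all `V'` in `S(TN)`.) -/
def B₂ (J : ∀ x : M, TangentSpace 𝓘(ℝ, E) x →L[ℝ] TangentSpace 𝓘(ℝ, E) x) (x : N) :
    L.screenTransversal x →ₗ[ℝ] (L.screen x).map (L.d x) :=
  (((L.screen x).map (L.d x)).projectionOnto
    ((L.rad x).map (L.d x) ⊔ (L.ltr x ⊔ L.screenTransversal x)) (L.isCompl_screen x)).comp
      ((J (L.f x)).toLinearMap.comp (L.screenTransversal x).subtype)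

end LightlikeSubmanifold

end Submanifold

end Lightlike

end

/-!
Identify `TN` with its image in `TM`, and write `∇̆` for the covariant derivative along the
immersion. Two facts combine.

The induced connection is metric exactly when `g(∇̆_W ξ, u) = 0` for all radical fields `ξ` and all
`u` in the screen distribution (`isMetricConnection_inducedConnection_iff`). Indeed, the defect
`(∇_W g)(U, V)` only involves the radical parts of `U` and `V`, since `ltr(TN) ⊕ S(TN^⊥)` is
orthogonal to the screen distribution. Differentiating the relation `g(ξ, Y) = 0`, valid for
radical `ξ` and tangential `Y`, moves the derivative onto the radical parts. Since the hypothesis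
on `∇̆_W ξ` concerns radical fields defined on all of `N`, this uses that a radical vector extends
to such a field (`exists_isSmoothField_rad`).

On the other side, `J` is parallel and self-adjoint, and `J TN ⊆ S(TN^⊥)`, whence
`g(J ∇^s_W J ξ, u) = g(∇̆_W ξ, J² u) = p g(∇̆_W ξ, J u) + q g(∇̆_W ξ, u)`. The first summand
vanishes (`inner_covAlong_map_eq_zero`): the trilinear form `g(∇̆_X Y, J Z)` on `TN` is symmetric
in `X, Y`, because `∇̆` is torsion-free and `J Z` is normal, and skew in `Y, Z`, because
`g(J Y, Z) = 0`. A trilinear form with these two symmetries is zero. As `q ≠ 0` and the metric is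
nondegenerate on the screen distribution, `B₂ ∇^s_W J ξ = 0` says that `∇̆_W ξ` is orthogonal to
the screen distribution, which is the first condition.

The Leibniz rule for the metric and the parallelism of `J` along the immersion are reduced to fields
on `M` by expanding in a local frame of `TM` (`DiffAlongAt.induction`). The symmetry in `X, Y` is
tensorial, so it suffices to check it on coordinate fields of `N`, where it amounts to the symmetry
of second derivatives (`covAlong_mfderiv_extend_comm`).
-/

noncomputable section

namespace Lightlike

/-! ### Covariant derivative along a map -/

section AlongCalculus

variable {E : Type*} [NormedAddCommGroup E] [NormedSpace ℝ E] [FiniteDimensional ℝ E]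
  {M : Type*} [TopologicalSpace M] [ChartedSpace E M] [IsManifold 𝓘(ℝ, E) ∞ M]
  {E' : Type*} [NormedAddCommGroup E'] [NormedSpace ℝ E'] [FiniteDimensional ℝ E']
  {N : Type*} [TopologicalSpace N] [ChartedSpace E' N] [IsManifold 𝓘(ℝ, E') ∞ N]

/-- The vector field `V` along `f` is differentiable at `x`, as a map `N → TM`. -/
abbrev DiffAlongAt (f : N → M) (V : ∀ x : N, TangentSpace 𝓘(ℝ, E) (f x)) (x : N) : Prop :=
  MDifferentiableAt 𝓘(ℝ, E') 𝓘(ℝ, E).tangent (fun y ↦ (⟨f y, V y⟩ : TangentBundle 𝓘(ℝ, E) M)) x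

/-- The vector field `V` along `f` in the trivialization of `TM` at `f x`. -/
def alongCoord (f : N → M) (x : N) (V : ∀ x : N, TangentSpace 𝓘(ℝ, E) (f x)) (y : N) : E :=
  (trivializationAt E (TangentSpace 𝓘(ℝ, E) : M → Type _) (f x)).continuousLinearMapAt ℝ (f y) (V y)

theorem covAlong_apply
    (cov : CovariantDerivative 𝓘(ℝ, E) E (TangentSpace 𝓘(ℝ, E) : M → Type _))
    (f : N → M) (V : ∀ x : N, TangentSpace 𝓘(ℝ, E) (f x)) (x : N) (w : TangentSpace 𝓘(ℝ, E') x) :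
    covAlong cov f V x w =
      (trivializationAt E (TangentSpace 𝓘(ℝ, E) : M → Type _) (f x)).symmL ℝ (f x)
        (mvfderiv 𝓘(ℝ, E') (alongCoord f x V) x w) +
      cov (FiberBundle.extend E (V x)) (f x) (mfderiv 𝓘(ℝ, E') 𝓘(ℝ, E) f x w) := rfl

variable {f : N → M} {x : N} {V V' : ∀ x : N, TangentSpace 𝓘(ℝ, E) (f x)}

theorem eventually_mem_baseSet (hf : ContinuousAt f x) :
    ∀ᶠ y in nhds x,
      f y ∈ (trivializationAt E (TangentSpace 𝓘(ℝ, E) : M → Type _) (f x)).baseSet :=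
  hf.preimage_mem_nhds ((trivializationAt E _ (f x)).open_baseSet.mem_nhds
    (FiberBundle.mem_baseSet_trivializationAt' (f x)))

theorem diffAlongAt_iff (hf : MDifferentiableAt 𝓘(ℝ, E') 𝓘(ℝ, E) f x) :
    DiffAlongAt (E' := E') f V x ↔ MDifferentiableAt 𝓘(ℝ, E') 𝓘(ℝ, E) (alongCoord f x V) x := by
  have h : (fun y ↦ (trivializationAt E (TangentSpace 𝓘(ℝ, E) : M → Type _) (f x)
      (⟨f y, V y⟩ : TangentBundle 𝓘(ℝ, E) M)).2) =ᶠ[nhds x] alongCoord f x V := by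
    filter_upwards [eventually_mem_baseSet (E := E) hf.continuousAt] with y hy
    rw [alongCoord, Trivialization.continuousLinearMapAt_apply,
      Trivialization.coe_linearMapAt_of_mem _ hy]
  rw [DiffAlongAt, mdifferentiableAt_totalSpace]
  constructor
  · rintro ⟨-, h2⟩
    exact h2.congr_of_eventuallyEq h.symm
  · exact fun h2 ↦ ⟨hf, h2.congr_of_eventuallyEq h⟩

theorem DiffAlongAt.mdifferentiableAt_base (hV : DiffAlongAt (E' := E') f V x) :
    MDifferentiableAt 𝓘(ℝ, E') 𝓘(ℝ, E) f x :=
  ((mdifferentiableAt_totalSpace _ _).1 hV).1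

theorem alongCoord_add : alongCoord f x (V + V') = alongCoord f x V + alongCoord f x V' := by
  funext y; simp [alongCoord]

theorem alongCoord_smul (a : N → ℝ) :
    alongCoord f x (fun y ↦ a y • V y) = a • alongCoord f x V := by
  funext y; simp [alongCoord]

theorem DiffAlongAt.add (hV : DiffAlongAt (E' := E') f V x) (hV' : DiffAlongAt (E' := E') f V' x) :
    DiffAlongAt (E' := E') f (V + V') x := by
  have hf := hV.mdifferentiableAt_base
  rw [diffAlongAt_iff hf] at hV hV' ⊢
  rw [alongCoord_add]
  exact hV.add hV'

theorem DiffAlongAt.smul {a : N → ℝ} (ha : MDifferentiableAt 𝓘(ℝ, E') 𝓘(ℝ, ℝ) a x)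
    (hV : DiffAlongAt (E' := E') f V x) : DiffAlongAt (E' := E') f (fun y ↦ a y • V y) x := by
  have hf := hV.mdifferentiableAt_base
  rw [diffAlongAt_iff hf] at hV ⊢
  rw [alongCoord_smul]
  exact ha.smul hV

theorem DiffAlongAt.comp {Y : ∀ y : M, TangentSpace 𝓘(ℝ, E) y}
    (hf : MDifferentiableAt 𝓘(ℝ, E') 𝓘(ℝ, E) f x)
    (hY : MDifferentiableAt 𝓘(ℝ, E) 𝓘(ℝ, E).tangent
      (fun y ↦ (⟨y, Y y⟩ : TangentBundle 𝓘(ℝ, E) M)) (f x)) :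
    DiffAlongAt (E' := E') f (fun y ↦ Y (f y)) x :=
  MDifferentiableAt.comp x (g := fun y ↦ (⟨y, Y y⟩ : TangentBundle 𝓘(ℝ, E) M)) hY hf

variable (cov : CovariantDerivative 𝓘(ℝ, E) E (TangentSpace 𝓘(ℝ, E) : M → Type _))

theorem extend_eq_symmL (z : M) (u : TangentSpace 𝓘(ℝ, E) z) :
    ∀ᶠ y in nhds z, FiberBundle.extend E u y =
      (trivializationAt E (TangentSpace 𝓘(ℝ, E) : M → Type _) z).symmL ℝ y
        ((trivializationAt E (TangentSpace 𝓘(ℝ, E) : M → Type _) z).continuousLinearMapAt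
          ℝ z u) := by
  filter_upwards [eventually_mem_baseSet (E := E) (f := id) (x := z) continuousAt_id]
    with y (hy : y ∈ (trivializationAt E (TangentSpace 𝓘(ℝ, E) : M → Type _) z).baseSet)
  rw [Trivialization.continuousLinearMapAt_apply, Trivialization.coe_linearMapAt_of_mem _
    (FiberBundle.mem_baseSet_trivializationAt' z), Trivialization.symmL_apply _ hy]
  rfl

theorem cov_extend_add (z : M) (u v : TangentSpace 𝓘(ℝ, E) z) :
    cov (FiberBundle.extend E (u + v)) z =
      cov (FiberBundle.extend E u) z + cov (FiberBundle.extend E v) z := by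
  have hu := FiberBundle.mdifferentiableAt_extend 𝓘(ℝ, E) E u
  have hv := FiberBundle.mdifferentiableAt_extend 𝓘(ℝ, E) E v
  rw [← cov.isCovariantDerivativeOn.add hu hv]
  refine cov.isCovariantDerivativeOn.congr_of_eventuallyEq
    (FiberBundle.mdifferentiableAt_extend ..) (mdifferentiableAt_add_section hu hv)
    Filter.univ_mem ?_
  filter_upwards [extend_eq_symmL z u, extend_eq_symmL z v, extend_eq_symmL z (u + v)]
    with y h1 h2 h3
  rw [Pi.add_apply, h1, h2, h3, map_add, map_add]

theorem cov_extend_smul (z : M) (c : ℝ) (u : TangentSpace 𝓘(ℝ, E) z) :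
    cov (FiberBundle.extend E (c • u)) z = c • cov (FiberBundle.extend E u) z := by
  have hu := FiberBundle.mdifferentiableAt_extend 𝓘(ℝ, E) E u
  have h := cov.isCovariantDerivativeOn.leibniz (g := fun _ ↦ c) hu mdifferentiableAt_const
  rw [mvfderiv_const] at h
  have h2 : cov (FiberBundle.extend E (c • u)) z =
      cov ((fun _ : M ↦ c) • FiberBundle.extend E u) z := by
    refine cov.isCovariantDerivativeOn.congr_of_eventuallyEq
      (FiberBundle.mdifferentiableAt_extend ..) (mdifferentiableAt_const.smul_section hu)
      Filter.univ_mem ?_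
    filter_upwards [extend_eq_symmL z u, extend_eq_symmL z (c • u)] with y h1 h3
    rw [Pi.smul_apply', h1, h3, map_smul, map_smul]
  rw [h2, h]
  ext; simp

theorem covAlong_congr (h : ∀ᶠ y in nhds x, V y = V' y) :
    covAlong (E' := E') cov f V x = covAlong cov f V' x := by
  ext w
  have h1 : alongCoord f x V =ᶠ[nhds x] alongCoord f x V' := by
    filter_upwards [h] with y hy
    rw [alongCoord, alongCoord, hy]
  rw [covAlong_apply, covAlong_apply, h.self_of_nhds, mvfderiv, mvfderiv, h1.mfderiv_eq]
  rfl

theorem covAlong_add (hV : DiffAlongAt (E' := E') f V x) (hV' : DiffAlongAt (E' := E') f V' x) :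
    covAlong (E' := E') cov f (V + V') x = covAlong cov f V x + covAlong cov f V' x := by
  ext w
  have hf := hV.mdifferentiableAt_base
  rw [diffAlongAt_iff hf] at hV hV'
  simp only [add_apply, covAlong_apply, alongCoord_add, mvfderiv_add hV hV', Pi.add_apply,
    cov_extend_add, map_add]
  abel

theorem covAlong_smul {a : N → ℝ} (ha : MDifferentiableAt 𝓘(ℝ, E') 𝓘(ℝ, ℝ) a x)
    (hV : DiffAlongAt (E' := E') f V x) (w : TangentSpace 𝓘(ℝ, E') x) :
    covAlong (E' := E') cov f (fun y ↦ a y • V y) x w =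
      a x • covAlong cov f V x w + mvfderiv 𝓘(ℝ, E') a x w • V x := by
  have hf := hV.mdifferentiableAt_base
  rw [diffAlongAt_iff hf] at hV
  have h2 :=
    (trivializationAt E (TangentSpace 𝓘(ℝ, E) : M → Type _) (f x)).symmL_continuousLinearMapAt
      (R := ℝ) (FiberBundle.mem_baseSet_trivializationAt' (f x)) (V x)
  simp only [covAlong_apply, alongCoord_smul, mvfderiv_smul ha hV, cov_extend_smul, add_apply,
    smul_apply, ContinuousLinearMap.smulRight_apply, map_add, map_smul]
  rw [alongCoord, h2]
  module

/-- A property of differentiable vector fields along `f` which is local, additive, stable under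
multiplication by differentiable functions, and true for `Y ∘ f` with `Y` a vector field on the
target, holds for all of them: near `x` a field along `f` is a combination of a frame of `TM`. -/
theorem DiffAlongAt.induction (hV : DiffAlongAt (E' := E') f V x)
    {P : (∀ x : N, TangentSpace 𝓘(ℝ, E) (f x)) → Prop}
    (congr : ∀ U U' : ∀ x : N, TangentSpace 𝓘(ℝ, E) (f x),
      (∀ᶠ y in nhds x, U y = U' y) → P U → P U')
    (add : ∀ U U', DiffAlongAt (E' := E') f U x → DiffAlongAt (E' := E') f U' x →
      P U → P U' → P (U + U'))
    (smul : ∀ (a : N → ℝ) (U), MDifferentiableAt 𝓘(ℝ, E') 𝓘(ℝ, ℝ) a x →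
      DiffAlongAt (E' := E') f U x → P U → P (fun y ↦ a y • U y))
    (comp : ∀ Y : ∀ y : M, TangentSpace 𝓘(ℝ, E) y,
      MDifferentiableAt 𝓘(ℝ, E) 𝓘(ℝ, E).tangent
        (fun y ↦ (⟨y, Y y⟩ : TangentBundle 𝓘(ℝ, E) M)) (f x) → P (fun y ↦ Y (f y))) :
    P V := by
  have hf := hV.mdifferentiableAt_base
  set t := trivializationAt E (TangentSpace 𝓘(ℝ, E) : M → Type _) (f x) with ht
  have hx : f x ∈ t.baseSet := FiberBundle.mem_baseSet_trivializationAt' (f x)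
  let b := Module.finBasis ℝ E
  let e : Fin (Module.finrank ℝ E) → ∀ y : M, TangentSpace 𝓘(ℝ, E) y := fun i y ↦
    t.symmL ℝ y (b i)
  have he : ∀ i, MDifferentiableAt 𝓘(ℝ, E) 𝓘(ℝ, E).tangent
      (fun y ↦ (⟨y, e i y⟩ : TangentBundle 𝓘(ℝ, E) M)) (f x) := by
    intro i
    have := FiberBundle.mdifferentiableAt_extend 𝓘(ℝ, E) E (t.symmL ℝ (f x) (b i))
    refine this.congr_of_eventuallyEq ?_
    filter_upwards [extend_eq_symmL (f x) (t.symmL ℝ (f x) (b i))] with y hy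
    rw [hy]
    exact congrArg (fun v ↦ (⟨y, t.symmL ℝ y v⟩ : TangentBundle 𝓘(ℝ, E) M))
      (t.continuousLinearMapAt_symmL hx (b i)).symm
  let a : Fin (Module.finrank ℝ E) → N → ℝ := fun i y ↦ b.equivFunL (alongCoord f x V y) i
  have ha : ∀ i, MDifferentiableAt 𝓘(ℝ, E') 𝓘(ℝ, ℝ) (a i) x := by
    intro i
    have h1 := (diffAlongAt_iff hf).1 hV
    have h2 : MDifferentiableAt 𝓘(ℝ, E) 𝓘(ℝ, ℝ) (fun u ↦ b.equivFunL u i) (alongCoord f x V x) :=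
      ((ContinuousLinearMap.proj (R := ℝ) (φ := fun _ ↦ ℝ) i).comp
        b.equivFunL.toContinuousLinearMap).differentiableAt.mdifferentiableAt
    exact h2.comp x h1
  have hsum : ∀ s : Finset (Fin (Module.finrank ℝ E)),
      DiffAlongAt (E' := E') f (fun y ↦ ∑ i ∈ s, a i y • e i (f y)) x ∧
        P (fun y ↦ ∑ i ∈ s, a i y • e i (f y)) := by
    intro s
    induction s using Finset.induction_on with
    | empty =>
      have h0 : MDifferentiableAt 𝓘(ℝ, E) 𝓘(ℝ, E).tangent
          (fun y ↦ (⟨y, 0⟩ : TangentBundle 𝓘(ℝ, E) M)) (f x) := mdifferentiable_zeroSection ..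
      simp only [Finset.sum_empty]
      exact ⟨DiffAlongAt.comp (Y := fun _ ↦ 0) hf h0, comp (fun _ ↦ 0) h0⟩
    | insert i s hi ih =>
      simp only [Finset.sum_insert hi]
      have h1 := DiffAlongAt.comp hf (he i)
      exact ⟨(h1.smul (ha i)).add ih.1,
        add _ _ (h1.smul (ha i)) ih.1 (smul _ _ (ha i) h1 (comp _ (he i))) ih.2⟩
  refine congr _ _ ?_ (hsum Finset.univ).2
  filter_upwards [eventually_mem_baseSet (E := E) hf.continuousAt] with y hy
  have h1 := congrArg (t.symmL ℝ (f y)) (b.sum_equivFun (alongCoord f x V y))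
  rw [map_sum] at h1
  simp only [map_smul] at h1
  rw [alongCoord, t.symmL_continuousLinearMapAt hy] at h1
  exact h1

/-- A parallel `(1,1)`-tensor field commutes with the covariant derivative along `f`. -/
theorem covAlong_map {J : ∀ x : M, TangentSpace 𝓘(ℝ, E) x →L[ℝ] TangentSpace 𝓘(ℝ, E) x}
    (hJ : ContMDiff 𝓘(ℝ, E) (𝓘(ℝ, E).prod 𝓘(ℝ, E →L[ℝ] E)) ∞
      (fun x ↦ TotalSpace.mk' (E →L[ℝ] E)
        (E := fun x : M ↦ TangentSpace 𝓘(ℝ, E) x →L[ℝ] TangentSpace 𝓘(ℝ, E) x) x (J x)))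
    (hp : IsParallel cov J) (hV : DiffAlongAt (E' := E') f V x) :
    DiffAlongAt (E' := E') f (fun y ↦ J (f y) (V y)) x ∧
    ∀ w, covAlong (E' := E') cov f (fun y ↦ J (f y) (V y)) x w =
      J (f x) (covAlong cov f V x w) := by
  have hJ' := (hJ (f x)).mdifferentiableAt (by simp)
  have hf := hV.mdifferentiableAt_base
  have hd : ∀ U, DiffAlongAt (E' := E') f U x →
      DiffAlongAt (E' := E') f (fun y ↦ J (f y) (U y)) x := fun U hU ↦
    MDifferentiableAt.clm_bundle_apply (hJ'.comp x hf) hU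
  refine ⟨hd V hV, ?_⟩
  refine hV.induction (P := fun V ↦ ∀ w, covAlong (E' := E') cov f (fun y ↦ J (f y) (V y)) x w =
      J (f x) (covAlong cov f V x w)) ?_ ?_ ?_ ?_
  · intro U U' h hU w
    rw [← covAlong_congr cov h, ← hU w]
    rw [covAlong_congr cov]
    filter_upwards [h] with y hy
    rw [hy]
  · intro U U' hU hU' h h' w
    have : (fun y ↦ J (f y) ((U + U') y)) =
      (fun y ↦ J (f y) (U y)) + (fun y ↦ J (f y) (U' y)) := by funext y; simp
    rw [this, covAlong_add cov (hd U hU) (hd U' hU'), covAlong_add cov hU hU', add_apply, h, h',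
      add_apply, map_add]
  · intro a U ha hU h w
    have : (fun y ↦ J (f y) (a y • U y)) = fun y ↦ a y • J (f y) (U y) := by funext y; simp
    rw [this, covAlong_smul cov ha (hd U hU), covAlong_smul cov ha hU, h]
    simp
  · intro Y hY w
    have hJY : MDifferentiableAt 𝓘(ℝ, E) 𝓘(ℝ, E).tangent
        (fun y ↦ (⟨y, J y (Y y)⟩ : TangentBundle 𝓘(ℝ, E) M)) (f x) :=
      MDifferentiableAt.clm_bundle_apply hJ' hY
    rw [covAlong_comp cov f x hf (fun y ↦ J y (Y y)) hJY, covAlong_comp cov f x hf Y hY,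
      hp _ _ hY]

theorem mdifferentiableAt_inner (g : SemiRiemannianMetric E M)
    (hV : DiffAlongAt (E' := E') f V x) (hV' : DiffAlongAt (E' := E') f V' x) :
    MDifferentiableAt 𝓘(ℝ, E') 𝓘(ℝ, ℝ) (fun y ↦ g.inner (f y) (V y) (V' y)) x := by
  have h := ((g.contMDiff (f x)).mdifferentiableAt (by simp)).comp x hV.mdifferentiableAt_base
  have h2 : MDifferentiableAt 𝓘(ℝ, E') (𝓘(ℝ, E).prod 𝓘(ℝ, ℝ))
    (fun m ↦ TotalSpace.mk' ℝ (E := Bundle.Trivial M ℝ) (f m) (g.inner (f m) (V m) (V' m))) x :=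
    MDifferentiableAt.clm_bundle_apply₂ (F₃ := ℝ) (E₃ := Bundle.Trivial M ℝ) h hV hV'
  exact ((mdifferentiableAt_totalSpace _ _).1 h2).2

/-- A metric connection satisfies the Leibniz rule for the metric also along `f`. -/
theorem mvfderiv_inner_along {g : SemiRiemannianMetric E M} (hg : IsLeviCivita g cov)
    (hV : DiffAlongAt (E' := E') f V x) (hV' : DiffAlongAt (E' := E') f V' x)
    (w : TangentSpace 𝓘(ℝ, E') x) :
    mvfderiv 𝓘(ℝ, E') (fun y ↦ g.inner (f y) (V y) (V' y)) x w =
      g.inner (f x) (covAlong cov f V x w) (V' x) +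
        g.inner (f x) (V x) (covAlong cov f V' x w) := by
  have hf := hV.mdifferentiableAt_base
  have mvcongr : ∀ a b : N → ℝ, a =ᶠ[nhds x] b → mvfderiv 𝓘(ℝ, E') a x w =
      mvfderiv 𝓘(ℝ, E') b x w := by
    intro a b h
    rw [mvfderiv, mvfderiv, h.mfderiv_eq]
    rfl
  refine hV.induction (P := fun V ↦ mvfderiv 𝓘(ℝ, E') (fun y ↦ g.inner (f y) (V y) (V' y)) x w =
      g.inner (f x) (covAlong cov f V x w) (V' x) + g.inner (f x) (V x) (covAlong cov f V' x w))
      ?_ ?_ ?_ ?_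
  · intro U U' h hU
    rw [← covAlong_congr cov h, ← h.self_of_nhds, ← hU]
    apply mvcongr
    filter_upwards [h] with y hy
    rw [hy]
  · intro U U' hU hU' h h'
    have : (fun y ↦ g.inner (f y) ((U + U') y) (V' y)) =
        (fun y ↦ g.inner (f y) (U y) (V' y)) + (fun y ↦ g.inner (f y) (U' y) (V' y)) := by
      funext y; simp
    rw [this, mvfderiv_add (mdifferentiableAt_inner g hU hV') (mdifferentiableAt_inner g hU' hV'),
      covAlong_add cov hU hU', add_apply, h, h']
    simp only [add_apply, map_add, Pi.add_apply]
    abel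
  · intro a U ha hU h
    have : (fun y ↦ g.inner (f y) (a y • U y) (V' y)) =
        a * (fun y ↦ g.inner (f y) (U y) (V' y)) := by
      funext y; simp
    rw [this, mvfderiv_mul ha (mdifferentiableAt_inner g hU hV'), covAlong_smul cov ha hU]
    simp only [add_apply, smul_apply, h, map_add, map_smul, smul_eq_mul]
    ring
  · intro Y hY
    have hYf := DiffAlongAt.comp hf hY
    refine hV'.induction (P := fun V' ↦
      mvfderiv 𝓘(ℝ, E') (fun y ↦ g.inner (f y) (Y (f y)) (V' y)) x w =
        g.inner (f x) (covAlong cov f (fun y ↦ Y (f y)) x w) (V' x) +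
          g.inner (f x) (Y (f x)) (covAlong cov f V' x w)) ?_ ?_ ?_ ?_
    · intro U U' h hU
      rw [← covAlong_congr cov h, ← h.self_of_nhds, ← hU]
      apply mvcongr
      filter_upwards [h] with y hy
      rw [hy]
    · intro U U' hU hU' h h'
      have : (fun y ↦ g.inner (f y) (Y (f y)) ((U + U') y)) =
          (fun y ↦ g.inner (f y) (Y (f y)) (U y)) + (fun y ↦ g.inner (f y) (Y (f y)) (U' y)) := by
        funext y; simp
      rw [this, mvfderiv_add (mdifferentiableAt_inner g hYf hU) (mdifferentiableAt_inner g hYf hU'),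
        covAlong_add cov hU hU', add_apply, h, h']
      simp only [add_apply, map_add, Pi.add_apply]
      abel
    · intro a U ha hU h
      have : (fun y ↦ g.inner (f y) (Y (f y)) (a y • U y)) =
          a * (fun y ↦ g.inner (f y) (Y (f y)) (U y)) := by
        funext y; simp
      rw [this, mvfderiv_mul ha (mdifferentiableAt_inner g hYf hU), covAlong_smul cov ha hU]
      simp only [add_apply, smul_apply, h, map_add, map_smul, smul_eq_mul]
      ring
    · intro Z hZ
      rw [covAlong_comp cov f x hf Y hY, covAlong_comp cov f x hf Z hZ, ← hg.metric _ Y Z hY hZ]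
      have h1 := mdifferentiableAt_inner (f := id) (x := f x) g hY hZ
      have h3 := mfderiv_comp x h1 hf
      have h4 : mvfderiv 𝓘(ℝ, E') (fun y ↦ g.inner (f y) (Y (f y)) (Z (f y))) x =
        (mvfderiv 𝓘(ℝ, E) (fun y ↦ g.inner y (Y y) (Z y)) (f x)).comp
          (mfderiv 𝓘(ℝ, E') 𝓘(ℝ, E) f x) := by
        change mvfderiv 𝓘(ℝ, E') ((fun y ↦ g.inner (id y) (Y y) (Z y)) ∘ f) x = _
        rw [mvfderiv, h3]
        rfl
      rw [h4]
      rfl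

end AlongCalculus

/-! ### Symmetry of the second fundamental form -/

section TorsionAlong

variable {E : Type*} [NormedAddCommGroup E] [NormedSpace ℝ E] [FiniteDimensional ℝ E]
  {M : Type*} [TopologicalSpace M] [ChartedSpace E M] [IsManifold 𝓘(ℝ, E) ∞ M]
  {E' : Type*} [NormedAddCommGroup E'] [NormedSpace ℝ E'] [FiniteDimensional ℝ E']
  {N : Type*} [TopologicalSpace N] [ChartedSpace E' N] [IsManifold 𝓘(ℝ, E') ∞ N]

/-- Near `z`, the extension of a tangent vector `v` is the coordinate field with constant
coefficients `v` in the chart at `z`. -/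
theorem extend_eq_mfderiv_extChartAt_symm (z : M) (v : TangentSpace 𝓘(ℝ, E) z) :
    ∀ᶠ y in nhds z, FiberBundle.extend E v y =
      mfderiv 𝓘(ℝ, E) 𝓘(ℝ, E) (extChartAt 𝓘(ℝ, E) z).symm (extChartAt 𝓘(ℝ, E) z y) v := by
  filter_upwards [extend_eq_symmL z v,
    (chartAt E z).open_source.mem_nhds (mem_chart_source E z)] with y hy hys
  rw [hy, TangentBundle.symmL_trivializationAt hys,
    TangentBundle.continuousLinearMapAt_trivializationAt (mem_chart_source E z),
    mfderiv_extChartAt_self]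
  simp only [modelWithCornersSelf_coe, Set.range_id, mfderivWithin_univ]
  rfl

/-- Coordinate fields commute. -/
theorem mlieBracket_extend (z : M) (v w : TangentSpace 𝓘(ℝ, E) z) :
    VectorField.mlieBracket 𝓘(ℝ, E) (FiberBundle.extend E v) (FiberBundle.extend E w) z = 0 := by
  have key : ∀ u : TangentSpace 𝓘(ℝ, E) z,
      VectorField.mpullbackWithin 𝓘(ℝ, E) 𝓘(ℝ, E) (extChartAt 𝓘(ℝ, E) z).symm
        (FiberBundle.extend E u) Set.univ =ᶠ[nhds (extChartAt 𝓘(ℝ, E) z z)] fun _ ↦ u := by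
    intro u
    have h1 := (continuousAt_extChartAt_symm (I := 𝓘(ℝ, E)) z).eventually
      (by rw [extChartAt_to_inv]; exact extend_eq_mfderiv_extChartAt_symm z u)
    filter_upwards [h1, extChartAt_target_mem_nhds z] with y hy hyt
    rw [VectorField.mpullbackWithin_apply, hy, (extChartAt 𝓘(ℝ, E) z).right_inv hyt]
    have hinv : (mfderivWithin 𝓘(ℝ, E) 𝓘(ℝ, E) (extChartAt 𝓘(ℝ, E) z).symm
        Set.univ y).IsInvertible := by
      have := isInvertible_mfderivWithin_extChartAt_symm (I := 𝓘(ℝ, E)) hyt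
      simpa using this
    rw [mfderivWithin_univ] at hinv ⊢
    exact hinv.inverse_apply_eq.2 rfl
  have hconst : ∀ (a b : E → E) {u u' p : E},
      a =ᶠ[nhds p] (fun _ ↦ u) → b =ᶠ[nhds p] (fun _ ↦ u') →
      VectorField.lieBracketWithin ℝ a b Set.univ p = 0 := by
    intro a b u u' p ha hb
    rw [VectorField.lieBracketWithin_univ, ha.lieBracket_vectorField_eq hb]
    simp [VectorField.lieBracket]
  have hb : VectorField.lieBracketWithin ℝ
      (VectorField.mpullbackWithin 𝓘(ℝ, E) 𝓘(ℝ, E) (extChartAt 𝓘(ℝ, E) z).symm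
        (FiberBundle.extend E v) Set.univ : E → E)
      (VectorField.mpullbackWithin 𝓘(ℝ, E) 𝓘(ℝ, E) (extChartAt 𝓘(ℝ, E) z).symm
        (FiberBundle.extend E w) Set.univ : E → E) Set.univ (extChartAt 𝓘(ℝ, E) z z) = 0 :=
    hconst _ _ (key v) (key w)
  rw [← VectorField.mlieBracketWithin_univ, VectorField.mlieBracketWithin_apply]
  simp only [modelWithCornersSelf_coe, Set.range_id, Set.preimage_univ, Set.inter_univ]
  exact (congrArg _ hb).trans (map_zero _)

/-- For a torsion-free connection the covariant derivative of the coordinate fields of `N` along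
`f` is symmetric: their coefficients are first derivatives of `f` in charts, and second derivatives
commute. -/
theorem covAlong_mfderiv_extend_comm
    {cov : CovariantDerivative 𝓘(ℝ, E) E (TangentSpace 𝓘(ℝ, E) : M → Type _)}
    {g : SemiRiemannianMetric E M} (hg : IsLeviCivita g cov) {f : N → M}
    (hf : ContMDiff 𝓘(ℝ, E') 𝓘(ℝ, E) ∞ f) (x : N) (v w : TangentSpace 𝓘(ℝ, E') x) :
    covAlong cov f (fun y ↦ mfderiv 𝓘(ℝ, E') 𝓘(ℝ, E) f y (FiberBundle.extend E' v y)) x w =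
      covAlong cov f (fun y ↦ mfderiv 𝓘(ℝ, E') 𝓘(ℝ, E) f y (FiberBundle.extend E' w y)) x v := by
  set φ := extChartAt 𝓘(ℝ, E') x with hφ
  set ψ := extChartAt 𝓘(ℝ, E) (f x) with hψ
  let F : E' → E := fun z ↦ ψ (f (φ.symm z))
  have hF : ContDiffAt ℝ ∞ F (φ x) := by
    rw [← contMDiffAt_iff_contDiffAt]
    have h1 : ContMDiffAt 𝓘(ℝ, E') 𝓘(ℝ, E') ∞ φ.symm (φ x) :=
      (contMDiffOn_extChartAt_symm x).contMDiffAt (extChartAt_target_mem_nhds x)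
    have h2 : ContMDiffAt 𝓘(ℝ, E) 𝓘(ℝ, E) ∞ ψ (f x) := contMDiffAt_extChartAt
    have hx : φ.symm (φ x) = x := extChartAt_to_inv x
    have h3 : ContMDiffAt 𝓘(ℝ, E') 𝓘(ℝ, E) ∞ (ψ ∘ f) (φ.symm (φ x)) := by
      rw [hx]; exact h2.comp x (hf x)
    exact h3.comp _ h1
  -- the coefficients of `f_* ∂_u` at `y` are the entries of the derivative of `F` at `φ y`
  have hc : ∀ u : TangentSpace 𝓘(ℝ, E') x,
      alongCoord f x (fun y ↦ mfderiv 𝓘(ℝ, E') 𝓘(ℝ, E) f y (FiberBundle.extend E' u y))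
        =ᶠ[nhds x] fun y ↦ fderiv ℝ F (φ y) u := by
    intro u
    filter_upwards [extend_eq_mfderiv_extChartAt_symm x u,
      (chartAt E' x).open_source.mem_nhds (mem_chart_source E' x),
      hf.continuous.continuousAt.preimage_mem_nhds
        ((chartAt E (f x)).open_source.mem_nhds (mem_chart_source E (f x)))] with y hy hyx hyf
    have hyi : φ.symm (φ y) = y := φ.left_inv (by rwa [hφ, extChartAt_source])
    have hyt : φ y ∈ φ.target := φ.map_source (by rwa [hφ, extChartAt_source])
    have h1 : MDifferentiableAt 𝓘(ℝ, E') 𝓘(ℝ, E') φ.symm (φ y) :=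
      ((contMDiffOn_extChartAt_symm (n := ∞) x).contMDiffAt
        ((isOpen_extChartAt_target x).mem_nhds hyt)).mdifferentiableAt (by simp)
    have h2 : MDifferentiableAt 𝓘(ℝ, E) 𝓘(ℝ, E) ψ (f y) := mdifferentiableAt_extChartAt hyf
    have h3 : MDifferentiableAt 𝓘(ℝ, E') 𝓘(ℝ, E) f y := (hf y).mdifferentiableAt (by simp)
    rw [alongCoord, TangentBundle.continuousLinearMapAt_trivializationAt hyf, hy,
      ← mfderiv_eq_fderiv]
    have h4 : ∀ y' : N, y' = y → ∀ a : E',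
        (mfderiv 𝓘(ℝ, E) 𝓘(ℝ, E) ψ (f y') (mfderiv 𝓘(ℝ, E') 𝓘(ℝ, E) f y' a) : E) =
          mfderiv 𝓘(ℝ, E) 𝓘(ℝ, E) ψ (f y) (mfderiv 𝓘(ℝ, E') 𝓘(ℝ, E) f y a) := by
      rintro _ rfl _
      rfl
    rw [← hyi] at h2 h3
    have h5 : mfderiv 𝓘(ℝ, E') 𝓘(ℝ, E) F (φ y) = _ :=
      mfderiv_comp (φ y) (g := ψ) (f := f ∘ φ.symm) h2 (h3.comp (φ y) h1)
    rw [h5, mfderiv_comp (φ y) h3 h1]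
    exact (h4 _ hyi _).symm
  have hd : ∀ u u' : E',
      mvfderiv 𝓘(ℝ, E') (alongCoord f x
        (fun y ↦ mfderiv 𝓘(ℝ, E') 𝓘(ℝ, E) f y (FiberBundle.extend E' (x := x) u y))) x u' =
      fderiv ℝ (fderiv ℝ F) (φ x) u' u := by
    intro u u'
    have hdd : DifferentiableAt ℝ (fderiv ℝ F) (φ x) :=
      (hF.fderiv_right (m := 1) (by norm_cast)).differentiableAt (by simp)
    have h1 : HasFDerivAt (fun z ↦ fderiv ℝ F z u)
        ((ContinuousLinearMap.apply ℝ E u).comp (fderiv ℝ (fderiv ℝ F) (φ x))) (φ x) :=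
      (ContinuousLinearMap.apply ℝ E u).hasFDerivAt.comp (φ x) hdd.hasFDerivAt
    have h2 := (mdifferentiableAt_extChartAt (I := 𝓘(ℝ, E')) (mem_chart_source E' x)).hasMFDerivAt
    rw [mfderiv_extChartAt_self] at h2
    have h3 := h1.hasMFDerivAt.comp x h2
    rw [mvfderiv, (hc u).mfderiv_eq]
    erw [h3.mfderiv]
    rfl
  have hsymm' : fderiv ℝ (fderiv ℝ F) (φ x) w v = fderiv ℝ (fderiv ℝ F) (φ x) v w :=
    (hF.isSymmSndFDerivAt (by
      simp only [minSmoothness_of_isRCLikeNormedField]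
      exact WithTop.coe_le_coe.2 (le_top : (2 : ℕ∞) ≤ ⊤))).eq w v
  have hsymm : mvfderiv 𝓘(ℝ, E') (alongCoord f x
        (fun y ↦ mfderiv 𝓘(ℝ, E') 𝓘(ℝ, E) f y (FiberBundle.extend E' v y))) x w =
      mvfderiv 𝓘(ℝ, E') (alongCoord f x
        (fun y ↦ mfderiv 𝓘(ℝ, E') 𝓘(ℝ, E) f y (FiberBundle.extend E' w y))) x v :=
    (hd v w).trans (hsymm'.trans (hd w v).symm)
  have htor := hg.torsion_eq_zero
  have := FiniteDimensional.complete ℝ E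
  rw [CovariantDerivative.torsion_eq_zero_iff] at htor
  have ht := htor (FiberBundle.mdifferentiableAt_extend 𝓘(ℝ, E) E (mfderiv 𝓘(ℝ, E') 𝓘(ℝ, E) f x w))
    (FiberBundle.mdifferentiableAt_extend 𝓘(ℝ, E) E (mfderiv 𝓘(ℝ, E') 𝓘(ℝ, E) f x v))
  rw [mlieBracket_extend, FiberBundle.extend_apply_self, FiberBundle.extend_apply_self,
    sub_eq_zero] at ht
  rw [covAlong_apply, covAlong_apply, hsymm, FiberBundle.extend_apply_self,
    FiberBundle.extend_apply_self, ht]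

theorem DiffAlongAt.mfderiv {f : N → M} (hf : ContMDiff 𝓘(ℝ, E') 𝓘(ℝ, E) ∞ f) {x : N}
    {U : ∀ x : N, TangentSpace 𝓘(ℝ, E') x}
    (hU : MDifferentiableAt 𝓘(ℝ, E') 𝓘(ℝ, E').tangent
      (fun y ↦ (⟨y, U y⟩ : TangentBundle 𝓘(ℝ, E') N)) x) :
    DiffAlongAt (E' := E') f (fun y ↦ mfderiv 𝓘(ℝ, E') 𝓘(ℝ, E) f y (U y)) x := by
  have h := (hf.contMDiff_tangentMap (m := 1) (by norm_cast)).mdifferentiableAt (by simp)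
    (x := (⟨x, U x⟩ : TangentBundle 𝓘(ℝ, E') N))
  exact h.comp x hU

/-- The second fundamental form is symmetric: for tangential fields `U`, `U'` and a normal vector
`η`, the number `g(∇̆_{U'} U, η)` depends on `U x` and `U' x` only, and symmetrically. -/
theorem inner_covAlong_mfderiv_comm
    {cov : CovariantDerivative 𝓘(ℝ, E) E (TangentSpace 𝓘(ℝ, E) : M → Type _)}
    {g : SemiRiemannianMetric E M} (hg : IsLeviCivita g cov) {f : N → M}
    (hf : ContMDiff 𝓘(ℝ, E') 𝓘(ℝ, E) ∞ f) {x : N}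
    {U U' : ∀ x : N, TangentSpace 𝓘(ℝ, E') x}
    (hU : MDifferentiableAt 𝓘(ℝ, E') 𝓘(ℝ, E').tangent
      (fun y ↦ (⟨y, U y⟩ : TangentBundle 𝓘(ℝ, E') N)) x)
    (hU' : MDifferentiableAt 𝓘(ℝ, E') 𝓘(ℝ, E').tangent
      (fun y ↦ (⟨y, U' y⟩ : TangentBundle 𝓘(ℝ, E') N)) x)
    {η : TangentSpace 𝓘(ℝ, E) (f x)} (hη : η ∈ normalSpace (E' := E') g f x) :
    g.inner (f x) (covAlong cov f (fun y ↦ mfderiv 𝓘(ℝ, E') 𝓘(ℝ, E) f y (U y)) x (U' x)) η =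
      g.inner (f x) (covAlong cov f (fun y ↦ mfderiv 𝓘(ℝ, E') 𝓘(ℝ, E) f y (U' y)) x (U x)) η := by
  have key : ∀ w : TangentSpace 𝓘(ℝ, E') x, TensorialAt 𝓘(ℝ, E') E'
      (fun U : ∀ x : N, TangentSpace 𝓘(ℝ, E') x ↦
        g.inner (f x) (covAlong cov f (fun y ↦ mfderiv 𝓘(ℝ, E') 𝓘(ℝ, E) f y (U y)) x w) η) x := by
    intro w
    constructor
    · intro a U ha hU
      have h1 : (fun y ↦ mfderiv 𝓘(ℝ, E') 𝓘(ℝ, E) f y ((a • U) y)) =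
          fun y ↦ a y • mfderiv 𝓘(ℝ, E') 𝓘(ℝ, E) f y (U y) := by funext y; simp
      rw [h1, covAlong_smul cov ha (DiffAlongAt.mfderiv hf hU), map_add, map_smul, map_smul,
        add_apply, smul_apply, smul_apply, g.symm _ (mfderiv 𝓘(ℝ, E') 𝓘(ℝ, E) f x (U x)), hη (U x)]
      simp
    · intro U U' hU hU'
      have h1 : (fun y ↦ mfderiv 𝓘(ℝ, E') 𝓘(ℝ, E) f y ((U + U') y)) =
          (fun y ↦ mfderiv 𝓘(ℝ, E') 𝓘(ℝ, E) f y (U y)) +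
            fun y ↦ mfderiv 𝓘(ℝ, E') 𝓘(ℝ, E) f y (U' y) := by funext y; simp
      rw [h1, covAlong_add cov (DiffAlongAt.mfderiv hf hU) (DiffAlongAt.mfderiv hf hU')]
      simp
  have hext := fun V : ∀ x : N, TangentSpace 𝓘(ℝ, E') x ↦
    FiberBundle.mdifferentiableAt_extend 𝓘(ℝ, E') E' (V x)
  have h1 := (key (U' x)).pointwise hU (hext U) (by simp)
  have h2 := (key (U x)).pointwise hU' (hext U') (by simp)
  rw [h1, h2, covAlong_mfderiv_extend_comm hg hf]

end TorsionAlong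

/-! ### Extension of tangent vectors and of radical vectors -/

section Extension

variable {E : Type*} [NormedAddCommGroup E] [NormedSpace ℝ E] [FiniteDimensional ℝ E]
  {M : Type*} [TopologicalSpace M] [ChartedSpace E M] [IsManifold 𝓘(ℝ, E) ∞ M]
  {E' : Type*} [NormedAddCommGroup E'] [NormedSpace ℝ E'] [FiniteDimensional ℝ E']
  {N : Type*} [TopologicalSpace N] [ChartedSpace E' N] [IsManifold 𝓘(ℝ, E') ∞ N]

theorem contMDiffOn_det {k : ℕ} {A : N → Matrix (Fin k) (Fin k) ℝ} {u : Set N}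
    (hA : ∀ i j, ContMDiffOn 𝓘(ℝ, E') 𝓘(ℝ, ℝ) ∞ (fun y ↦ A y i j) u) :
    ContMDiffOn 𝓘(ℝ, E') 𝓘(ℝ, ℝ) ∞ (fun y ↦ (A y).det) u := by
  simp only [Matrix.det_apply']
  refine contMDiffOn_finsetSum fun σ _ ↦ ?_
  exact contMDiffOn_const.mul (contMDiffOn_finsetProd fun i _ ↦ hA _ _)

theorem contMDiffOn_adjugate {k : ℕ} {A : N → Matrix (Fin k) (Fin k) ℝ} {u : Set N}
    (hA : ∀ i j, ContMDiffOn 𝓘(ℝ, E') 𝓘(ℝ, ℝ) ∞ (fun y ↦ A y i j) u) (i j : Fin k) :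
    ContMDiffOn 𝓘(ℝ, E') 𝓘(ℝ, ℝ) ∞ (fun y ↦ (A y).adjugate i j) u := by
  simp only [Matrix.adjugate_apply]
  refine contMDiffOn_det fun a b ↦ ?_
  by_cases h : a = j
  · subst h
    simp only [Matrix.updateRow_self]
    exact contMDiffOn_const
  · simp only [Matrix.updateRow_ne h]
    exact hA a b

theorem contMDiffOn_inner (g : SemiRiemannianMetric E M) {f : N → M}
    (hf : ContMDiff 𝓘(ℝ, E') 𝓘(ℝ, E) ∞ f)
    {u : Set N} {V V' : ∀ x : N, TangentSpace 𝓘(ℝ, E) (f x)}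
    (hV : ContMDiffOn 𝓘(ℝ, E') 𝓘(ℝ, E).tangent ∞
      (fun x ↦ (⟨f x, V x⟩ : TangentBundle 𝓘(ℝ, E) M)) u)
    (hV' : ContMDiffOn 𝓘(ℝ, E') 𝓘(ℝ, E).tangent ∞
      (fun x ↦ (⟨f x, V' x⟩ : TangentBundle 𝓘(ℝ, E) M)) u) :
    ContMDiffOn 𝓘(ℝ, E') 𝓘(ℝ, ℝ) ∞ (fun y ↦ g.inner (f y) (V y) (V' y)) u := by
  have h := (g.contMDiff.comp hf).contMDiffOn (s := u)
  have h2 : ContMDiffOn 𝓘(ℝ, E') (𝓘(ℝ, E).prod 𝓘(ℝ, ℝ)) ∞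
    (fun m ↦ TotalSpace.mk' ℝ (E := Bundle.Trivial M ℝ) (f m) (g.inner (f m) (V m) (V' m))) u :=
    ContMDiffOn.clm_bundle_apply₂ (F₃ := ℝ) (E₃ := Bundle.Trivial M ℝ) h hV hV'
  exact fun y hy ↦ ((contMDiffWithinAt_totalSpace).1 (h2 y hy)).2

theorem contMDiffOn_mfderiv {f : N → M} (hf : ContMDiff 𝓘(ℝ, E') 𝓘(ℝ, E) ∞ f) {u : Set N}
    {U : ∀ x : N, TangentSpace 𝓘(ℝ, E') x}
    (hU : ContMDiffOn 𝓘(ℝ, E') 𝓘(ℝ, E').tangent ∞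
      (fun y ↦ (⟨y, U y⟩ : TangentBundle 𝓘(ℝ, E') N)) u) :
    ContMDiffOn 𝓘(ℝ, E') 𝓘(ℝ, E).tangent ∞
      (fun y ↦ (⟨f y, mfderiv 𝓘(ℝ, E') 𝓘(ℝ, E) f y (U y)⟩ : TangentBundle 𝓘(ℝ, E) M)) u :=
  (hf.contMDiff_tangentMap (m := ∞) (by simp)).comp_contMDiffOn hU

variable [T2Space N]

/-- Multiplication by a bump function `χ` at `x` turns a vector field which is smooth on a
neighbourhood of `x` into a global one. -/
theorem exists_bump_smul_isSmoothField {u : Set N} (hu : IsOpen u) {x : N} (hx : x ∈ u)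
    {U : ∀ x : N, TangentSpace 𝓘(ℝ, E') x}
    (hU : ContMDiffOn 𝓘(ℝ, E') 𝓘(ℝ, E').tangent ∞
      (fun y ↦ (⟨y, U y⟩ : TangentBundle 𝓘(ℝ, E') N)) u) :
    ∃ χ : N → ℝ, χ x = 1 ∧ (∀ y ∉ u, χ y = 0) ∧ IsSmoothField (fun y ↦ χ y • U y) := by
  obtain ⟨χ, -, hχ⟩ := (SmoothBumpFunction.nhds_basis_tsupport (I := 𝓘(ℝ, E')) x).mem_iff.1
    (hu.mem_nhds hx)
  refine ⟨χ, χ.eq_one, fun y hy ↦ image_eq_zero_of_notMem_tsupport fun h ↦ hy (hχ h), ?_⟩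
  exact ContMDiffOn.smul_section_of_tsupport χ.contMDiff.contMDiffOn hu hχ hU

theorem exists_isSmoothField (x : N) (v : TangentSpace 𝓘(ℝ, E') x) :
    ∃ V : ∀ x : N, TangentSpace 𝓘(ℝ, E') x, IsSmoothField V ∧ V x = v := by
  obtain ⟨u, hu, h⟩ := FiberBundle.exists_contMDiffOn_extend 𝓘(ℝ, E') E' (k := ∞) v
  obtain ⟨u', hu', ho, hx⟩ := mem_nhds_iff.1 hu
  obtain ⟨χ, h1, -, h2⟩ := exists_bump_smul_isSmoothField ho hx (h.mono hu')
  exact ⟨_, h2, by simp [h1]⟩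

end Extension

namespace LightlikeSubmanifold

variable {E : Type*} [NormedAddCommGroup E] [NormedSpace ℝ E] [FiniteDimensional ℝ E]
  {M : Type*} [TopologicalSpace M] [ChartedSpace E M] [IsManifold 𝓘(ℝ, E) ∞ M]
  {E' : Type*} [NormedAddCommGroup E'] [NormedSpace ℝ E'] [FiniteDimensional ℝ E']
  {N : Type*} [TopologicalSpace N] [ChartedSpace E' N] [IsManifold 𝓘(ℝ, E') ∞ N]
  {g : SemiRiemannianMetric E M} (L : LightlikeSubmanifold E' N g)

theorem mem_rad_iff {x : N} {v : TangentSpace 𝓘(ℝ, E') x} :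
    v ∈ L.rad x ↔ ∀ w, g.inner (L.f x) (L.d x v) (L.d x w) = 0 := Iff.rfl

theorem exists_rad_add_screen (x : N) (v : TangentSpace 𝓘(ℝ, E') x) :
    ∃ r ∈ L.rad x, ∃ s ∈ L.screen x, r + s = v :=
  Submodule.mem_sup.1 ((L.screen_isCompl x).sup_eq_top ▸ Submodule.mem_top)

theorem mem_rad_of_forall_screen {x : N} {v : TangentSpace 𝓘(ℝ, E') x}
    (h : ∀ u ∈ L.screen x, g.inner (L.f x) (L.d x v) (L.d x u) = 0) : v ∈ L.rad x := by
  intro w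
  obtain ⟨r, hr, s, hs, rfl⟩ := L.exists_rad_add_screen x w
  have h1 := h s hs
  have h2 := L.mem_rad_iff.1 hr v
  rw [g.symm] at h2
  change g.inner (L.f x) (L.d x v) (L.d x (r + s)) = 0
  rw [map_add, map_add, h1, h2, add_zero]

/-- The induced metric is nondegenerate on the screen distribution. -/
theorem eq_zero_of_mem_screen {x : N} {v : TangentSpace 𝓘(ℝ, E') x} (hv : v ∈ L.screen x)
    (h : ∀ u ∈ L.screen x, g.inner (L.f x) (L.d x v) (L.d x u) = 0) : v = 0 :=
  Submodule.disjoint_def.1 (L.screen_isCompl x).disjoint v (L.mem_rad_of_forall_screen h) hv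

/-- Every vector of `Rad(T_xN)` extends to a global smooth section of `Rad(TN)`. In a local frame
`s` of the screen distribution with Gram matrix `G`, the projection of a field `X` to `Rad(TN)`
is `X - ∑ i, (G⁻¹ b) i • s i` with `b i = g(X, s i)`. -/
theorem exists_isSmoothField_rad [T2Space N] (x : N) {ξ₀ : TangentSpace 𝓘(ℝ, E') x}
    (hξ₀ : ξ₀ ∈ L.rad x) :
    ∃ ξ : ∀ x : N, TangentSpace 𝓘(ℝ, E') x,
      IsSmoothField ξ ∧ (∀ y, ξ y ∈ L.rad y) ∧ ξ x = ξ₀ := by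
  obtain ⟨u, hu, hxu, k, (s : Fin k → ∀ y : N, TangentSpace 𝓘(ℝ, E') y), hs, hspan⟩ :=
    L.screen_smooth x
  have hf := L.isImmersion.contMDiff
  replace hs : ∀ i, ContMDiffOn 𝓘(ℝ, E') 𝓘(ℝ, E').tangent ∞
    (fun y ↦ (⟨y, s i y⟩ : TangentBundle 𝓘(ℝ, E') N)) u := hs
  have hmem : ∀ y ∈ u, ∀ i, s i y ∈ L.screen y := fun y hy i ↦ by
    rw [← (hspan y hy).2]; exact Submodule.subset_span ⟨i, rfl⟩
  let B : ∀ y : N, TangentSpace 𝓘(ℝ, E') y → TangentSpace 𝓘(ℝ, E') y → ℝ := fun y v w ↦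
    g.inner (L.f y) (L.d y v) (L.d y w)
  have horth : ∀ y ∈ u, ∀ v : TangentSpace 𝓘(ℝ, E') y, (∀ i, B y v (s i y) = 0) → v ∈ L.rad y := by
    intro y hy v hv
    refine L.mem_rad_of_forall_screen fun w hw ↦ ?_
    rw [← (hspan y hy).2] at hw
    induction hw using Submodule.span_induction with
    | mem w hw => obtain ⟨i, rfl⟩ := hw; exact hv i
    | zero => simp
    | add a b _ _ ha hb => rw [map_add, map_add, ha, hb, add_zero]
    | smul c a _ ha => rw [map_smul, map_smul, ha, smul_zero]
  let G : ∀ y : N, Matrix (Fin k) (Fin k) ℝ := fun y i j ↦ B y (s j y) (s i y)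
  have hB : ∀ V W : ∀ y : N, TangentSpace 𝓘(ℝ, E') y,
      ContMDiffOn 𝓘(ℝ, E') 𝓘(ℝ, E').tangent ∞
        (fun y ↦ (⟨y, V y⟩ : TangentBundle 𝓘(ℝ, E') N)) u →
      ContMDiffOn 𝓘(ℝ, E') 𝓘(ℝ, E').tangent ∞
        (fun y ↦ (⟨y, W y⟩ : TangentBundle 𝓘(ℝ, E') N)) u →
      ContMDiffOn 𝓘(ℝ, E') 𝓘(ℝ, ℝ) ∞ (fun y ↦ B y (V y) (W y)) u := fun V W hV hW ↦
    contMDiffOn_inner g hf (contMDiffOn_mfderiv hf hV) (contMDiffOn_mfderiv hf hW)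
  have hBsum : ∀ (y : N) (c : Fin k → ℝ) (i : Fin k),
      B y (∑ j, c j • s j y) (s i y) = (G y).mulVec c i := by
    intro y c i
    simp [B, G, Matrix.mulVec, dotProduct, mul_comm]
  -- `S(TN)` meets `Rad(TN)` trivially, so the Gram matrix is invertible
  have hdet : (G x).det ≠ 0 := by
    intro h0
    obtain ⟨c, hc, hGc⟩ := Matrix.exists_mulVec_eq_zero_iff.2 h0
    have h1 : ∑ j, c j • s j x ∈ L.rad x := horth x hxu _ fun i ↦ by rw [hBsum, hGc]; rfl
    have h2 : ∑ j, c j • s j x ∈ L.screen x :=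
      Submodule.sum_mem _ fun j _ ↦ Submodule.smul_mem _ _ (hmem x hxu j)
    have h3 := Submodule.disjoint_def.1 (L.screen_isCompl x).disjoint _ h1 h2
    exact hc (funext fun j ↦ Fintype.linearIndependent_iff.1 (hspan x hxu).1 c h3 j)
  obtain ⟨X, hX, hXx⟩ := exists_isSmoothField x ((G x).det⁻¹ • ξ₀)
  let b : N → Fin k → ℝ := fun y j ↦ B y (X y) (s j y)
  -- The projection of `X` is multiplied by `det G`, so that `G⁻¹` is replaced by the adjugate,
  -- which is polynomial in the entries of `G`.
  let c : N → Fin k → ℝ := fun y ↦ (G y).adjugate.mulVec (b y)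
  let ζ : ∀ y : N, TangentSpace 𝓘(ℝ, E') y := fun y ↦
    (G y).det • X y - ∑ j, c y j • s j y
  have hGs : ∀ i j, ContMDiffOn 𝓘(ℝ, E') 𝓘(ℝ, ℝ) ∞ (fun y ↦ G y i j) u := fun i j ↦
    hB _ _ (hs j) (hs i)
  have hcs : ∀ j, ContMDiffOn 𝓘(ℝ, E') 𝓘(ℝ, ℝ) ∞ (fun y ↦ c y j) u := by
    intro j
    simp only [c, Matrix.mulVec, dotProduct]
    exact contMDiffOn_finsetSum fun i _ ↦
      (contMDiffOn_adjugate hGs j i).mul (hB _ _ hX.contMDiffOn (hs i))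
  have hζ : ContMDiffOn 𝓘(ℝ, E') 𝓘(ℝ, E').tangent ∞
      (fun y ↦ (⟨y, ζ y⟩ : TangentBundle 𝓘(ℝ, E') N)) u := by
    have h1 := (contMDiffOn_det hGs).smul_section hX.contMDiffOn
    have h2 := ContMDiffOn.sum_section (s := Finset.univ) (fun j _ ↦ (hcs j).smul_section (hs j))
    exact h1.sub_section h2
  have hζr : ∀ y ∈ u, ζ y ∈ L.rad y := by
    intro y hy
    refine horth y hy _ fun i ↦ ?_
    have h1 : B y (ζ y) (s i y) = (G y).det * b y i - B y (∑ j, c y j • s j y) (s i y) := by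
      simp only [B, ζ, b, map_sub, map_smul, sub_apply, smul_apply, smul_eq_mul]
    rw [h1, hBsum]
    simp only [c]
    rw [Matrix.mulVec_mulVec, Matrix.mul_adjugate, Matrix.smul_mulVec, Matrix.one_mulVec]
    simp
  have hζx : ζ x = ξ₀ := by
    have h1 : b x = 0 := by
      funext j
      have := L.mem_rad_iff.1 hξ₀ (s j x)
      simp only [b, B, hXx, map_smul, smul_apply, this, smul_zero, Pi.zero_apply]
    simp only [ζ, c, h1, Matrix.mulVec_zero, Pi.zero_apply, zero_smul, Finset.sum_const_zero,
      sub_zero, hXx, smul_smul, mul_inv_cancel₀ hdet, one_smul]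
  obtain ⟨χ, h1, h2, h3⟩ := exists_bump_smul_isSmoothField hu hxu hζ
  refine ⟨_, h3, fun y ↦ ?_, by simp [h1, hζx]⟩
  by_cases hy : y ∈ u
  · exact Submodule.smul_mem _ _ (hζr y hy)
  · rw [h2 y hy, zero_smul]
    exact Submodule.zero_mem _

end LightlikeSubmanifold

/-! ### Anti-invariant lightlike submanifolds -/

namespace LightlikeSubmanifold

variable {E : Type*} [NormedAddCommGroup E] [NormedSpace ℝ E] [FiniteDimensional ℝ E]
  {M : Type*} [TopologicalSpace M] [ChartedSpace E M] [IsManifold 𝓘(ℝ, E) ∞ M]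
  {E' : Type*} [NormedAddCommGroup E'] [NormedSpace ℝ E'] [FiniteDimensional ℝ E']
  {N : Type*} [TopologicalSpace N] [ChartedSpace E' N] [IsManifold 𝓘(ℝ, E') ∞ N]
  {g : SemiRiemannianMetric E M} (L : LightlikeSubmanifold E' N g)

theorem screenTransversal_le_normalSpace (x : N) :
    L.screenTransversal x ≤ normalSpace (E' := E') g L.f x :=
  L.screenTransversal_sup x ▸ le_sup_right

theorem inner_screenTransversal_d {x : N} {z : TangentSpace 𝓘(ℝ, E) (L.f x)}
    (hz : z ∈ L.screenTransversal x) (v : TangentSpace 𝓘(ℝ, E') x) :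
    g.inner (L.f x) z (L.d x v) = 0 :=
  L.screenTransversal_le_normalSpace x hz v

theorem inner_transversal_screen {x : N} {τ : TangentSpace 𝓘(ℝ, E) (L.f x)}
    (hτ : τ ∈ L.ltr x ⊔ L.screenTransversal x) {u : TangentSpace 𝓘(ℝ, E') x}
    (hu : u ∈ L.screen x) : g.inner (L.f x) τ (L.d x u) = 0 := by
  obtain ⟨n, hn, z, hz, rfl⟩ := Submodule.mem_sup.1 hτ
  have h1 : g.inner (L.f x) n (L.d x u) = 0 := L.ltr_orthogonal_screen x n hn u hu
  rw [map_add, add_apply, h1, L.inner_screenTransversal_d hz, add_zero]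

theorem diffAlongAt_d {U : ∀ x : N, TangentSpace 𝓘(ℝ, E') x} (hU : IsSmoothField U) (x : N) :
    DiffAlongAt (E' := E') L.f (fun y ↦ L.d y (U y)) x :=
  DiffAlongAt.mfderiv L.isImmersion.contMDiff ((hU x).mdifferentiableAt (by simp))

variable {cov : CovariantDerivative 𝓘(ℝ, E) E (TangentSpace 𝓘(ℝ, E) : M → Type _)}

theorem covAlong_sub_inducedConnection_mem (U : ∀ x : N, TangentSpace 𝓘(ℝ, E') x) (x : N)
    (w : TangentSpace 𝓘(ℝ, E') x) :
    covAlong cov L.f (fun y ↦ L.d y (U y)) x w - L.d x (L.inducedConnection cov U x w) ∈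
      L.ltr x ⊔ L.screenTransversal x := by
  rw [← LinearMap.ker_linearProjOfIsCompl _ (L.d x) (L.d_injective x) (L.isCompl_transversal x),
    LinearMap.mem_ker, map_sub]
  exact sub_eq_zero.2 (LinearMap.linearProjOfIsCompl_apply_left ..).symm

theorem inner_inducedConnection_screen (U : ∀ x : N, TangentSpace 𝓘(ℝ, E') x) {x : N}
    (w : TangentSpace 𝓘(ℝ, E') x) {u : TangentSpace 𝓘(ℝ, E') x} (hu : u ∈ L.screen x) :
    g.inner (L.f x) (L.d x (L.inducedConnection cov U x w)) (L.d x u) =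
      g.inner (L.f x) (covAlong cov L.f (fun y ↦ L.d y (U y)) x w) (L.d x u) := by
  have h := L.inner_transversal_screen (L.covAlong_sub_inducedConnection_mem (cov := cov) U x w) hu
  rw [map_sub, sub_apply, sub_eq_zero] at h
  exact h.symm

/-- `g(∇̆_W U, V)` and `g(∇_W U, V)` differ by `g(∇̆_W U, b)`, with `b` the radical part of `V`. -/
theorem inner_covAlong_sub_inducedConnection (U : ∀ x : N, TangentSpace 𝓘(ℝ, E') x) {x : N}
    (w : TangentSpace 𝓘(ℝ, E') x) {b s : TangentSpace 𝓘(ℝ, E') x} (hb : b ∈ L.rad x)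
    (hs : s ∈ L.screen x) :
    g.inner (L.f x) (covAlong cov L.f (fun y ↦ L.d y (U y)) x w) (L.d x (b + s)) -
      g.inner (L.f x) (L.d x (L.inducedConnection cov U x w)) (L.d x (b + s)) =
    g.inner (L.f x) (covAlong cov L.f (fun y ↦ L.d y (U y)) x w) (L.d x b) := by
  have h1 := L.inner_inducedConnection_screen (cov := cov) U w hs
  have h2 := L.mem_rad_iff.1 hb (L.inducedConnection cov U x w)
  rw [g.symm] at h2
  simp only [map_add]
  rw [h1, h2]
  ring

/-- The induced connection is metric exactly when `∇̆_W ξ` is orthogonal to the screen distribution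
for all radical fields `ξ`. -/
theorem isMetricConnection_inducedConnection_iff [T2Space N] (hg : IsLeviCivita g cov) :
    L.IsMetricConnection (L.inducedConnection cov) ↔
      ∀ W ξ : ∀ x : N, TangentSpace 𝓘(ℝ, E') x, IsSmoothField W → IsSmoothField ξ →
        (∀ x, ξ x ∈ L.rad x) → ∀ x, ∀ u ∈ L.screen x,
          g.inner (L.f x) (covAlong cov L.f (fun y ↦ L.d y (ξ y)) x (W x)) (L.d x u) = 0 := by
  constructor
  · intro h W ξ hW hξ hr x u hu
    obtain ⟨V, hV, rfl⟩ := exists_isSmoothField x u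
    have h1 := h W ξ V hW hξ hV x
    have h2 : (fun y ↦ L.inducedMetric y (ξ y) (V y)) = fun _ ↦ (0 : ℝ) := by
      funext y
      exact L.mem_rad_iff.1 (hr y) (V y)
    have h3 : L.inducedMetric x (ξ x) (L.inducedConnection cov V x (W x)) = 0 :=
      L.mem_rad_iff.1 (hr x) _
    rw [h2, mvfderiv_const, h3, zero_apply] at h1
    rw [← L.inner_inducedConnection_screen ξ (W x) hu]
    simpa [inducedMetric] using h1
  · intro h W U V hW hU hV x
    obtain ⟨a, ha, s, hs, has⟩ := L.exists_rad_add_screen x (U x)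
    obtain ⟨b, hb, t, ht, hbt⟩ := L.exists_rad_add_screen x (V x)
    obtain ⟨α, hα, hαr, rfl⟩ := L.exists_isSmoothField_rad x ha
    obtain ⟨β, hβ, hβr, rfl⟩ := L.exists_isSmoothField_rad x hb
    -- differentiating `g(β, Y) = 0` for a radical field `β`
    have key : ∀ β Y : ∀ x : N, TangentSpace 𝓘(ℝ, E') x, IsSmoothField β → IsSmoothField Y →
        (∀ x, β x ∈ L.rad x) →
        g.inner (L.f x) (covAlong cov L.f (fun y ↦ L.d y (β y)) x (W x)) (L.d x (Y x)) +
          g.inner (L.f x) (L.d x (β x)) (covAlong cov L.f (fun y ↦ L.d y (Y y)) x (W x)) = 0 := by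
      intro β Y hβ hY hr
      rw [← mvfderiv_inner_along cov hg (L.diffAlongAt_d hβ x) (L.diffAlongAt_d hY x)]
      have h2 : (fun y ↦ g.inner (L.f y) (L.d y (β y)) (L.d y (Y y))) = fun _ ↦ (0 : ℝ) := by
        funext y
        exact L.mem_rad_iff.1 (hr y) (Y y)
      rw [h2, mvfderiv_const, zero_apply]
    have e1 := key β U hβ hU hβr
    have e2 := key α V hα hV hαr
    have e3 := key α β hα hβ hαr
    have e4 := L.inner_covAlong_sub_inducedConnection (cov := cov) U (W x) hb ht
    have e5 := L.inner_covAlong_sub_inducedConnection (cov := cov) V (W x) ha hs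
    have e6 := h W β hW hβ hβr x s hs
    have e7 := h W α hW hα hαr x t ht
    have e8 := mvfderiv_inner_along cov hg (L.diffAlongAt_d hU x) (L.diffAlongAt_d hV x) (W x)
    rw [hbt] at e4
    rw [has] at e5
    rw [← has, map_add, map_add, e6, add_zero] at e1
    rw [← hbt, map_add, map_add, e7, add_zero] at e2
    simp only [inducedMetric]
    rw [e8]
    rw [g.symm _ (L.d x (U x)) (L.d x _)]
    rw [g.symm _ (L.d x (U x)) (covAlong cov L.f _ x (W x))]
    rw [g.symm _ (L.d x (β x)) (covAlong cov L.f _ x (W x))] at e1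
    rw [g.symm _ (L.d x (α x)) (covAlong cov L.f _ x (W x))] at e2 e3
    linarith

variable {J : ∀ x : M, TangentSpace 𝓘(ℝ, E) x →L[ℝ] TangentSpace 𝓘(ℝ, E) x} {p q : ℕ}

theorem IsScreenTransversalAntiInvariant.map_d_mem {L : LightlikeSubmanifold E' N g}
    (hL : L.IsScreenTransversalAntiInvariant J) (x : N) (v : TangentSpace 𝓘(ℝ, E') x) :
    J (L.f x) (L.d x v) ∈ L.screenTransversal x := by
  obtain ⟨r, hr, s, hs, rfl⟩ := L.exists_rad_add_screen x v
  rw [map_add, map_add]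
  exact Submodule.add_mem _ (hL.rad x r hr) (hL.screen x s hs)

/-- On an anti-invariant submanifold the second fundamental form has no component along `J TN`:
the trilinear form `g(∇̆_U V, J Z)` is symmetric in `U, V` because the connection is torsion-free,
and skew in `V, Z` because `J` is parallel and `J V ⟂ TN`. -/
theorem inner_covAlong_map_eq_zero {L : LightlikeSubmanifold E' N g}
    (hL : L.IsScreenTransversalAntiInvariant J) (hM : IsLocallyMetallic g cov p q J)
    {U V Z : ∀ x : N, TangentSpace 𝓘(ℝ, E') x} (hU : IsSmoothField U) (hV : IsSmoothField V)
    (hZ : IsSmoothField Z) (x : N) :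
    g.inner (L.f x) (covAlong cov L.f (fun y ↦ L.d y (V y)) x (U x))
      (J (L.f x) (L.d x (Z x))) = 0 := by
  let σ : (∀ x : N, TangentSpace 𝓘(ℝ, E') x) → (∀ x : N, TangentSpace 𝓘(ℝ, E') x) →
      (∀ x : N, TangentSpace 𝓘(ℝ, E') x) → ℝ := fun U V Z ↦
    g.inner (L.f x) (covAlong cov L.f (fun y ↦ L.d y (V y)) x (U x)) (J (L.f x) (L.d x (Z x)))
  have symm : ∀ U V Z, IsSmoothField U → IsSmoothField V → σ U V Z = σ V U Z := by
    intro U V Z hU hV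
    exact inner_covAlong_mfderiv_comm hM.isLeviCivita L.isImmersion.contMDiff
      ((hV x).mdifferentiableAt (by simp)) ((hU x).mdifferentiableAt (by simp))
      (L.screenTransversal_le_normalSpace x (hL.map_d_mem x (Z x)))
  have skew : ∀ U V Z, IsSmoothField V → IsSmoothField Z → σ U V Z = -σ U Z V := by
    intro U V Z hV hZ
    obtain ⟨hd, hc⟩ := covAlong_map cov hM.isMetallic.contMDiff hM.isParallel
      (L.diffAlongAt_d hV x)
    have h1 := mvfderiv_inner_along cov hM.isLeviCivita hd (L.diffAlongAt_d hZ x) (U x)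
    have h2 : (fun y ↦ g.inner (L.f y) (J (L.f y) (L.d y (V y))) (L.d y (Z y))) =
        fun _ ↦ (0 : ℝ) := by
      funext y
      exact L.inner_screenTransversal_d (hL.map_d_mem y (V y)) (Z y)
    rw [h2, mvfderiv_const, zero_apply, hc, hM.isMetallic.compatible,
      g.symm _ (J (L.f x) (L.d x (V x)))] at h1
    simp only [σ]
    linarith
  -- transposing alternately the first two and the last two arguments six times gives `σ = -σ`
  have h1 := skew U V Z hV hZ
  have h2 := symm U Z V hU hZ
  have h3 := skew Z U V hU hV
  have h4 := symm Z V U hZ hV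
  have h5 := skew V Z U hZ hU
  have h6 := symm V U Z hV hU
  change σ U V Z = 0
  linarith

theorem B₂_eq_zero_iff {x : N} (Z : L.screenTransversal x) :
    L.B₂ J x Z = 0 ↔ ∀ u ∈ L.screen x, g.inner (L.f x) (J (L.f x) Z) (L.d x u) = 0 := by
  set C := (L.rad x).map (L.d x) ⊔ (L.ltr x ⊔ L.screenTransversal x) with hC
  have hCs : ∀ c ∈ C, ∀ u ∈ L.screen x, g.inner (L.f x) c (L.d x u) = 0 := by
    intro c hc u hu
    obtain ⟨_, ⟨r, hr, rfl⟩, τ, hτ, rfl⟩ := Submodule.mem_sup.1 hc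
    rw [map_add, add_apply, L.inner_transversal_screen hτ hu, L.mem_rad_iff.1 hr u, add_zero]
  have hmem : J (L.f x) Z - (L.B₂ J x Z : TangentSpace 𝓘(ℝ, E) (L.f x)) ∈ C :=
    Submodule.sub_projection_mem (L.isCompl_screen x) _
  have hB : ∀ u ∈ L.screen x, g.inner (L.f x) (J (L.f x) Z) (L.d x u) =
      g.inner (L.f x) (L.B₂ J x Z : TangentSpace 𝓘(ℝ, E) (L.f x)) (L.d x u) := fun u hu ↦ by
    have := hCs _ hmem u hu
    rwa [map_sub, sub_apply, sub_eq_zero] at this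
  constructor
  · intro h u hu
    rw [hB u hu, h]
    simp
  · intro h
    obtain ⟨s, hs, hsB⟩ := (L.B₂ J x Z).2
    have h0 : s = 0 := L.eq_zero_of_mem_screen hs fun u hu ↦ by
      rw [hsB, ← hB u hu, h u hu]
    rw [h0, map_zero] at hsB
    exact Subtype.ext hsB.symm

theorem inner_screenTransversalConnection {x : N} (Z : ∀ x : N, L.screenTransversal x)
    (w : TangentSpace 𝓘(ℝ, E') x) {z : TangentSpace 𝓘(ℝ, E) (L.f x)}
    (hz : z ∈ L.screenTransversal x) :
    g.inner (L.f x) (L.screenTransversalConnection cov Z x w : TangentSpace 𝓘(ℝ, E) (L.f x)) z =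
      g.inner (L.f x)
        (covAlong cov L.f (fun y ↦ (Z y : TangentSpace 𝓘(ℝ, E) (L.f y))) x w) z := by
  have hmem : covAlong cov L.f (fun y ↦ (Z y : TangentSpace 𝓘(ℝ, E) (L.f y))) x w -
      (L.screenTransversalConnection cov Z x w : TangentSpace 𝓘(ℝ, E) (L.f x)) ∈
        LinearMap.range (L.d x) ⊔ L.ltr x :=
    Submodule.sub_projection_mem (L.isCompl_screenTransversal x) _
  obtain ⟨_, ⟨v, rfl⟩, n, hn, h⟩ := Submodule.mem_sup.1 hmem
  have h1 : g.inner (L.f x) (L.d x v + n) z = 0 := by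
    rw [map_add, add_apply, L.ltr_orthogonal_screenTransversal x n hn z hz, g.symm,
      L.inner_screenTransversal_d hz, add_zero]
  rw [h, map_sub, sub_apply, sub_eq_zero] at h1
  exact h1.symm

/-- `g(J ∇^s_W J ξ, u) = g(∇̆_W ξ, J² u) = q g(∇̆_W ξ, u)` for tangential `u`. -/
theorem inner_map_screenTransversalConnection [T2Space N] {L : LightlikeSubmanifold E' N g}
    (hL : L.IsScreenTransversalAntiInvariant J) (hM : IsLocallyMetallic g cov p q J)
    {W ξ : ∀ x : N, TangentSpace 𝓘(ℝ, E') x} (hW : IsSmoothField W) (hξ : IsSmoothField ξ)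
    (hr : ∀ x, J (L.f x) (L.d x (ξ x)) ∈ L.screenTransversal x) (x : N)
    (u : TangentSpace 𝓘(ℝ, E') x) :
    g.inner (L.f x) (J (L.f x) (L.screenTransversalConnection cov
        (fun y ↦ ⟨J (L.f y) (L.d y (ξ y)), hr y⟩) x (W x))) (L.d x u) =
      q * g.inner (L.f x) (covAlong cov L.f (fun y ↦ L.d y (ξ y)) x (W x)) (L.d x u) := by
  obtain ⟨U, hU, rfl⟩ := exists_isSmoothField x u
  have hc := (covAlong_map cov hM.isMetallic.contMDiff hM.isParallel (L.diffAlongAt_d hξ x)).2 (W x)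
  rw [hM.isMetallic.compatible, L.inner_screenTransversalConnection _ _ (hL.map_d_mem x (U x)), hc,
    hM.isMetallic.compatible, hM.isMetallic.sq, map_add, map_smul, map_smul,
    inner_covAlong_map_eq_zero hL hM hW hξ hU x]
  simp

end LightlikeSubmanifold

end Lightlike

end

theorem mainTheorem2
    {E : Type*} [NormedAddCommGroup E] [NormedSpace ℝ E] [FiniteDimensional ℝ E]
    {M : Type*} [TopologicalSpace M] [ChartedSpace E M] [IsManifold 𝓘(ℝ, E) ∞ M] [T2Space M]
    {E' : Type*} [NormedAddCommGroup E'] [NormedSpace ℝ E'] [FiniteDimensional ℝ E']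
    {N : Type*} [TopologicalSpace N] [ChartedSpace E' N] [IsManifold 𝓘(ℝ, E') ∞ N] [T2Space N]
    (g : Lightlike.SemiRiemannianMetric E M)
    (cov : CovariantDerivative 𝓘(ℝ, E) E (TangentSpace 𝓘(ℝ, E) : M → Type _))
    (p q : ℕ)
    (J : ∀ x : M, TangentSpace 𝓘(ℝ, E) x →L[ℝ] TangentSpace 𝓘(ℝ, E) x)
    (hM : Lightlike.IsLocallyMetallic g cov p q J)
    (L : Lightlike.LightlikeSubmanifold E' N g)
    (hL : L.IsScreenTransversalAntiInvariant J) :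
    L.IsMetricConnection (L.inducedConnection cov) ↔
      ∀ W ξ : ∀ x : N, TangentSpace 𝓘(ℝ, E') x,
        Lightlike.IsSmoothField W → Lightlike.IsSmoothField ξ →
        ∀ hξ : ∀ x : N, ξ x ∈ L.rad x, ∀ x : N,
          L.B₂ J x (L.screenTransversalConnection cov
            (fun y ↦ ⟨J (L.f y) (L.d y (ξ y)), hL.rad y (ξ y) (hξ y)⟩) x (W x)) = 0 := by
  rw [L.isMetricConnection_inducedConnection_iff hM.isLeviCivita]
  refine forall_congr' fun W ↦ forall_congr' fun ξ ↦ forall_congr' fun hW ↦ forall_congr' fun hξ ↦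
    forall_congr' fun hr ↦ forall_congr' fun x ↦ ?_
  have hq : (q : ℝ) ≠ 0 := Nat.cast_ne_zero.2 hM.isMetallic.q_pos.ne'
  rw [L.B₂_eq_zero_iff]
  refine forall_congr' fun u ↦ forall_congr' fun _ ↦ ?_
  rw [Lightlike.LightlikeSubmanifold.inner_map_screenTransversalConnection hL hM hW hξ
    (fun y ↦ hL.rad y (ξ y) (hr y)) x u, mul_eq_zero, or_iff_right hq]
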